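/- All algebras are over $\mathbb{Q}$. For a graded vector space $W$, $\Lambda W$ denotes the free commutative graded algebra on $W$. A (simply connected, finite type) minimal Sullivan algebra is a commutative differential graded algebra (CDGA) of the form $(\Lambda W,d)$ with $W=W^{\ge 2}$ finite-dimensional in each degree, with $d$ nilpotent (there are subspaces $W(0)\subseteq W(1)\subseteq\cdots$ with union $W$, $d W(0)=0$ and $d W(k)\subseteq \Lambda W(k-1)$ for $k\ge 1$), and with $d(W)\subseteq \Lambda^{\ge 2}W$. A CDGA $A$ is $r$-connected if $H^0(A)=\mathbb{Q}$ and $H^i(A)=0$ for $1\le i\le r$. Two morphisms $f,g\colon A\to B$ of CDGAs are homotopic if there is a morphism $H\colon A\to B\otimes\Lambda(t,dt)$, where $|t|=0$ and $d(t)=dt$, whose compositions with the evaluations at $t=0$ and at $t=1$ are $f$ and $g$. For a Sullivan algebra $A$ this is an equivalence relation on the endomorphisms of $A$, and $\mathcal{E}(A)$ denotes the group of self-homotopy equivalences of $A$, i.e. the group of invertible elements of the monoid $[A,A]$ of homotopy classes of endomorphisms of $A$ under composition. Let $n\ge 1$ be an integer and let $\mathcal{G}=(V,E)$ be a finite, connected,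 simple (undirected) graph with more than one vertex. Let $M_n(\mathcal{G})$ be the CDGA which, as a commutative graded algebra, is free, $$M_n(\mathcal{G})=\Lambda(x_1,x_2,y_1,y_2,y_3,z)\otimes\Lambda(x_v,z_v\mid v\in V),$$ with degrees and differential $$\begin{array}{ll} |x_1| = 30n+18, & dx_1=0,\\ |x_2| = 36n+22, & dx_2=0,\\ |y_1| = 126n+75, & dy_1 = x_1^3 x_2,\\ |y_2| = 132n+79, & dy_2 = x_1^2 x_2^2,\\ |y_3| = 138n+83, & dy_3 = x_1 x_2^3,\\ |x_v| = 180n^2+218n+66, & dx_v = 0,\\ |z| = 540n^2+654n+197, & dz = x_1^{18n}(x_1^2y_2y_3-x_1x_2y_1y_3+x_2^2y_1y_2)+x_1^{18n+11}+x_2^{15n+9},\\ |z_v| = 540n^2+654n+197, & dz_v = x_v^3+\sum_{w\,:\,\{v,w\}\in E} x_vx_wx_2^{5n+3}. \end{array}$$ **Theorem.** $M_n(\mathcal{G})$ is a $(30n+17)$-connected minimal Sullivan algebra, and there is an isomorphism of groups $\mathcal{E}(M_n(\mathcal{G}))\cong\operatorname{Aut}(\mathcal{G})$. -/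

import Mathlib

open scoped DirectSum Polynomial

noncomputable section

universe u v

/-! ### Commutative differential graded algebras over `ℚ` -/

/-- A commutative differential graded algebra over `ℚ`, non-negatively (cohomologically) graded. -/
structure CDGA where
  carrier : Type u
  [ring : Ring carrier]
  [algebra : Algebra ℚ carrier]
  /-- the homogeneous elements of each degree -/
  gr : ℕ → Submodule ℚ carrier
  [graded : GradedAlgebra gr]
  mul_comm' : ∀ {i j : ℕ} {a b : carrier}, a ∈ gr i → b ∈ gr j →
    a * b = (-1 : ℚ) ^ (i * j) • (b * a)
  /-- the differential -/
  d : carrier →ₗ[ℚ] carrier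
  d_mem : ∀ {i : ℕ} {a : carrier}, a ∈ gr i → d a ∈ gr (i + 1)
  d_d : ∀ a, d (d a) = 0
  leibniz : ∀ {i : ℕ} {a : carrier} (b : carrier), a ∈ gr i →
    d (a * b) = d a * b + (-1 : ℚ) ^ i • (a * d b)

namespace CDGA

instance : CoeSort CDGA.{u} (Type u) := ⟨CDGA.carrier⟩

attribute [instance] CDGA.ring CDGA.algebra CDGA.graded

/-- Morphisms of CDGAs: algebra homomorphisms of degree zero commuting with the differentials. -/
@[ext]
structure Hom (A : CDGA.{u}) (B : CDGA.{v}) where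
  toAlgHom : A →ₐ[ℚ] B
  map_gr : ∀ {i : ℕ} {a : A}, a ∈ A.gr i → toAlgHom a ∈ B.gr i
  map_d : ∀ a : A, toAlgHom (A.d a) = B.d (toAlgHom a)

/-- The monoid of endomorphisms under composition, `f * g = f ∘ g`. -/
abbrev End (A : CDGA.{u}) := Hom A A

instance (A : CDGA.{u}) : Monoid (End A) where
  one := ⟨AlgHom.id ℚ A, fun h => h, fun _ => rfl⟩
  mul f g := ⟨f.toAlgHom.comp g.toAlgHom, fun h => f.map_gr (g.map_gr h), fun a => by
    rw [AlgHom.comp_apply, AlgHom.comp_apply, g.map_d, f.map_d]⟩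
  mul_assoc _ _ _ := rfl
  one_mul _ := rfl
  mul_one _ := rfl

lemma mem_iSup_gr (A : CDGA.{u}) (a : A) : a ∈ ⨆ i, A.gr i := by
  rw [(DirectSum.Decomposition.isInternal A.gr).submodule_iSup_eq_top]; trivial

/-- Induction on homogeneous elements. -/
lemma gr_induction (A : CDGA.{u}) {p : A → Prop} (h : ∀ i, ∀ a ∈ A.gr i, p a)
    (hadd : ∀ a b, p a → p b → p (a + b)) (a : A) : p a :=
  Submodule.iSup_induction A.gr (motive := p) (A.mem_iSup_gr a) h (h 0 0 (zero_mem _)) hadd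

/-- The degree involution as a linear map. -/
def signLin (A : CDGA.{u}) : A →ₗ[ℚ] A :=
  DirectSum.toModule ℚ ℕ A (fun i => (-1 : ℚ) ^ i • (A.gr i).subtype) ∘ₗ
    (DirectSum.decomposeLinearEquiv A.gr).toLinearMap

lemma signLin_of_mem (A : CDGA.{u}) {i : ℕ} {a : A} (h : a ∈ A.gr i) :
    A.signLin a = (-1 : ℚ) ^ i • a := by
  lift a to A.gr i using h
  simp [signLin, DirectSum.decomposeLinearEquiv, DirectSum.decompose_coe, ← DirectSum.lof_eq_of ℚ]

/-- The degree involution `a ↦ (-1)^|a| a`. -/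
def sign (A : CDGA.{u}) : A →ₐ[ℚ] A :=
  AlgHom.ofLinearMap A.signLin
    (by rw [A.signLin_of_mem (SetLike.GradedOne.one_mem)]; simp)
    (fun a b => by
      induction a using A.gr_induction with
      | hadd a a' ha ha' => rw [add_mul, map_add, map_add, add_mul, ha, ha']
      | h i a ha =>
        induction b using A.gr_induction with
        | hadd b b' hb hb' => rw [mul_add, map_add, map_add, mul_add, hb, hb']
        | h j b hb =>
          rw [A.signLin_of_mem (SetLike.GradedMul.mul_mem ha hb), A.signLin_of_mem ha,
            A.signLin_of_mem hb, smul_mul_smul_comm, pow_add])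

lemma sign_of_mem (A : CDGA.{u}) {i : ℕ} {a : A} (h : a ∈ A.gr i) :
    A.sign a = (-1 : ℚ) ^ i • a := A.signLin_of_mem h

lemma d_mul (A : CDGA.{u}) (a b : A) : A.d (a * b) = A.d a * b + A.sign a * A.d b := by
  induction a using A.gr_induction with
  | hadd a a' ha ha' => simp only [add_mul, map_add, ha, ha']; abel
  | h i a ha => rw [A.leibniz b ha, A.sign_of_mem ha, smul_mul_assoc]

lemma sign_sign (A : CDGA.{u}) (a : A) : A.sign (A.sign a) = a := by
  induction a using A.gr_induction with
  | hadd a a' ha ha' => simp only [map_add, ha, ha']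
  | h i a ha =>
    rw [A.sign_of_mem ha, map_smul, A.sign_of_mem ha, smul_smul, ← mul_pow]; simp

lemma d_sign (A : CDGA.{u}) (a : A) : A.d (A.sign a) = - A.sign (A.d a) := by
  induction a using A.gr_induction with
  | hadd a a' ha ha' => simp only [map_add, ha, ha', neg_add]
  | h i a ha =>
    rw [A.sign_of_mem ha, map_smul, A.sign_of_mem (A.d_mem ha), pow_succ]; simp

lemma Hom.map_sign {A : CDGA.{u}} {B : CDGA.{v}} (f : Hom A B) (a : A) :
    f.toAlgHom (A.sign a) = B.sign (f.toAlgHom a) := by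
  induction a using A.gr_induction with
  | hadd a a' ha ha' => simp only [map_add, ha, ha']
  | h i a ha => rw [A.sign_of_mem ha, map_smul, B.sign_of_mem (f.map_gr ha)]

end CDGA

/-! ### The free graded commutative algebra on a family of homogeneous generators -/

/-- The graded commutativity relations `ab = (-1)^(|a||b|) ba` between generators. Over `ℚ` they
force `a² = 0` for `|a|` odd. -/
inductive FreeCGA.Rel {I : Type u} (deg : I → ℕ) : FreeAlgebra ℚ I → FreeAlgebra ℚ I → Prop
  | comm (i j : I) : FreeCGA.Rel deg (FreeAlgebra.ι ℚ i * FreeAlgebra.ι ℚ j)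
      ((-1 : ℚ) ^ (deg i * deg j) • (FreeAlgebra.ι ℚ j * FreeAlgebra.ι ℚ i))

/-- The free commutative graded algebra `ΛW`, where `W` is the graded vector space with
basis `I`, the basis element `i` being of degree `deg i`. -/
def FreeCGA {I : Type u} (deg : I → ℕ) : Type u := RingQuot (FreeCGA.Rel deg)

namespace FreeCGA

variable {I : Type u} (deg : I → ℕ)

instance : Ring (FreeCGA deg) := inferInstanceAs (Ring (RingQuot (FreeCGA.Rel deg)))

instance : Algebra ℚ (FreeCGA deg) := inferInstanceAs (Algebra ℚ (RingQuot (FreeCGA.Rel deg)))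

/-- The generators. -/
def ι (i : I) : FreeCGA deg := RingQuot.mkAlgHom ℚ (FreeCGA.Rel deg) (FreeAlgebra.ι ℚ i)

lemma ι_mul_ι (i j : I) :
    ι deg i * ι deg j = (-1 : ℚ) ^ (deg i * deg j) • (ι deg j * ι deg i) := by
  have h := RingQuot.mkAlgHom_rel ℚ (Rel.comm (deg := deg) i j)
  rw [map_mul, map_smul, map_mul] at h
  exact h

variable {deg}

/-- The universal property of `ΛW`. -/
def lift {B : Type v} [Ring B] [Algebra ℚ B] (g : I → B)
    (hg : ∀ i j, g i * g j = (-1 : ℚ) ^ (deg i * deg j) • (g j * g i)) : FreeCGA deg →ₐ[ℚ] B :=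
  RingQuot.liftAlgHom ℚ ⟨FreeAlgebra.lift ℚ g, by
    rintro _ _ ⟨i, j⟩
    simp [hg i j]⟩

@[simp]
lemma lift_ι {B : Type v} [Ring B] [Algebra ℚ B] (g : I → B)
    (hg : ∀ i j, g i * g j = (-1 : ℚ) ^ (deg i * deg j) • (g j * g i)) (i : I) :
    lift g hg (ι deg i) = g i := by
  have := RingQuot.liftAlgHom_mkAlgHom_apply ℚ (FreeAlgebra.lift ℚ g) (s := Rel deg) (by
    rintro _ _ ⟨i, j⟩
    simp [hg i j]) (FreeAlgebra.ι ℚ i)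
  rw [FreeAlgebra.lift_ι_apply] at this
  exact this

@[ext]
lemma algHom_ext {B : Type v} [Ring B] [Algebra ℚ B] {f g : FreeCGA deg →ₐ[ℚ] B}
    (h : ∀ i, f (ι deg i) = g (ι deg i)) : f = g := by
  apply RingQuot.ringQuot_ext'
  apply FreeAlgebra.hom_ext
  funext i
  exact h i

variable (deg)

/-- The monomial with the given list of factors. -/
def mon (l : List I) : FreeCGA deg := (l.map (ι deg)).prod

/-- The degree of a monomial. -/
def wt (l : List I) : ℕ := (l.map deg).sum

/-- The elements of degree `n`: combinations of monomials of total degree `n`. -/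
def gr (n : ℕ) : Submodule ℚ (FreeCGA deg) := Submodule.span ℚ (mon deg '' {l | wt deg l = n})

variable {deg}

lemma mon_mem (l : List I) : mon deg l ∈ gr deg (wt deg l) := Submodule.subset_span ⟨l, rfl, rfl⟩

lemma ι_mem (i : I) : ι deg i ∈ gr deg (deg i) := by
  simpa [mon, wt] using mon_mem (deg := deg) [i]

instance : SetLike.GradedMonoid (gr deg) where
  one_mem := by simpa [mon, wt] using mon_mem (deg := deg) []
  mul_mem := by
    intro m n a b ha hb
    have h := Submodule.mul_mem_mul ha hb
    rw [gr, gr, Submodule.span_mul_span] at h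
    refine Submodule.span_mono ?_ h
    rintro _ ⟨_, ⟨l, hl, rfl⟩, _, ⟨l', hl', rfl⟩, rfl⟩
    refine ⟨l ++ l', ?_, by simp [mon]⟩
    simp only [Set.mem_ofPred_eq, wt] at hl hl' ⊢
    simp [hl, hl']

instance gradedAlgebra : GradedAlgebra (gr deg) :=
  GradedAlgebra.ofAlgHom (gr deg)
    (lift (fun i => DirectSum.of (fun n => gr deg n) (deg i) ⟨ι deg i, ι_mem i⟩) (by
      intro i j
      rw [DirectSum.of_mul_of, DirectSum.of_mul_of, ← DirectSum.lof_eq_of ℚ,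
        ← DirectSum.lof_eq_of ℚ, ← map_smul, DirectSum.lof_eq_of ℚ, DirectSum.lof_eq_of ℚ]
      exact DirectSum.of_eq_of_gradedMonoid_eq (Sigma.subtype_ext (add_comm _ _)
        (ι_mul_ι deg i j))))
    (by ext i; simp)
    (by
      rintro n ⟨x, hx⟩
      induction hx using Submodule.span_induction with
      | zero => simp only [map_zero]; exact (map_zero (DirectSum.of (fun n => gr deg n) n)).symm
      | add x y hx hy ihx ihy =>
        simp only [map_add] at ihx ihy ⊢
        rw [ihx, ihy, ← map_add]; rfl
      | smul c x hx ih =>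
        simp only [map_smul] at ih ⊢
        rw [ih, ← DirectSum.lof_eq_of ℚ, ← map_smul]; rfl
      | mem x hx =>
        obtain ⟨l, rfl, rfl⟩ := hx
        clear * -
        induction l with
        | nil => simp [mon]; rfl
        | cons i l ih =>
          simp only [mon, List.map_cons, List.prod_cons, map_mul, lift_ι] at ih ⊢
          rw [ih, DirectSum.of_mul_of]
          exact DirectSum.of_eq_of_gradedMonoid_eq (Sigma.subtype_ext (by
            change _ = (List.map deg (i :: l)).sum
            rw [List.map_cons, List.sum_cons]; rfl) rfl))

lemma ι_mul_mon (i : I) (l : List I) :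
    ι deg i * mon deg l = (-1 : ℚ) ^ (deg i * wt deg l) • (mon deg l * ι deg i) := by
  induction l with
  | nil => simp [mon, wt]
  | cons j l ih =>
    simp only [mon, wt, List.map_cons, List.prod_cons, List.sum_cons] at ih ⊢
    rw [← mul_assoc, ι_mul_ι, smul_mul_assoc, mul_assoc, ih, mul_smul_comm, smul_smul, mul_add,
      pow_add, mul_assoc]

lemma mon_mul_mon (l l' : List I) :
    mon deg l * mon deg l' = (-1 : ℚ) ^ (wt deg l * wt deg l') • (mon deg l' * mon deg l) := by
  induction l with
  | nil => simp [mon, wt]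
  | cons i l ih =>
    have e : mon deg (i :: l) = ι deg i * mon deg l := by simp [mon]
    have e' : wt deg (i :: l) = deg i + wt deg l := by simp [wt]
    rw [e, e', mul_assoc, ih, mul_smul_comm, ← mul_assoc, ι_mul_mon, smul_mul_assoc, smul_smul,
      mul_assoc, add_mul, pow_add, mul_comm ((-1 : ℚ) ^ _)]

lemma graded_comm {m n : ℕ} {a b : FreeCGA deg} (ha : a ∈ gr deg m) (hb : b ∈ gr deg n) :
    a * b = (-1 : ℚ) ^ (m * n) • (b * a) := by
  induction ha using Submodule.span_induction with
  | zero => simp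
  | add x y _ _ hx hy => rw [add_mul, hx, hy, mul_add, smul_add]
  | smul c x _ hx => rw [smul_mul_assoc, hx, mul_smul_comm, smul_comm]
  | mem x hx =>
    obtain ⟨l, rfl, rfl⟩ := hx
    induction hb using Submodule.span_induction with
    | zero => simp
    | add x y _ _ hx hy => rw [add_mul, mul_add, hx, hy, smul_add]
    | smul c x _ hx => rw [smul_mul_assoc, mul_smul_comm, hx, smul_comm]
    | mem x hx =>
      obtain ⟨l', rfl, rfl⟩ := hx
      exact mon_mul_mon l l'

section Derivation

variable (dg : I → FreeCGA deg) (hdg : ∀ i, dg i ∈ gr deg (deg i + 1))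

/-- The algebra map `a ↦ !![(-1)^|a| a, d a; 0, a]`, encoding the derivation `d` of degree one with
`d (ι i) = dg i`. -/
def derMat : FreeCGA deg →ₐ[ℚ] Matrix (Fin 2) (Fin 2) (FreeCGA deg) :=
  lift (fun i => !![(-1 : ℚ) ^ deg i • ι deg i, dg i; 0, ι deg i]) (by
    intro i j
    have h1 := graded_comm (ι_mem i) (hdg j)
    have h2 := graded_comm (hdg i) (ι_mem j)
    ext a b
    fin_cases a <;> fin_cases b
    · simp [Matrix.mul_apply, Fin.sum_univ_two, ι_mul_ι deg i j, smul_smul]; ring_nf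
    · simp [Matrix.mul_apply, Fin.sum_univ_two, h1, h2, smul_smul, add_mul, mul_add, pow_add]
      rw [mul_left_comm, ← mul_pow, add_comm]
      simp
    · simp [Matrix.mul_apply, Fin.sum_univ_two]
    · simp [Matrix.mul_apply, Fin.sum_univ_two, ι_mul_ι deg i j])

lemma derMat_ι (i : I) : derMat dg hdg (ι deg i) =
    !![(-1 : ℚ) ^ deg i • ι deg i, dg i; 0, ι deg i] := lift_ι _ _ _

/-- The derivation of degree one of `ΛW` with the given values on generators. -/
def der : FreeCGA deg →ₗ[ℚ] FreeCGA deg where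
  toFun a := derMat dg hdg a 0 1
  map_add' a b := by simp
  map_smul' c a := by simp

lemma der_ι (i : I) : der dg hdg (ι deg i) = dg i := by
  simp [der, derMat_ι]

lemma derMat_mon (l : List I) : derMat dg hdg (mon deg l) 0 0 = (-1 : ℚ) ^ wt deg l • mon deg l ∧
    derMat dg hdg (mon deg l) 1 0 = 0 ∧ derMat dg hdg (mon deg l) 1 1 = mon deg l := by
  induction l with
  | nil => simp [mon, wt]
  | cons i l ih =>
    have e : mon deg (i :: l) = ι deg i * mon deg l := by simp [mon]
    have e' : wt deg (i :: l) = deg i + wt deg l := by simp [wt]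
    rw [e, e', map_mul, derMat_ι]
    simp [Matrix.mul_apply, Fin.sum_univ_two, ih.1, ih.2.1, ih.2.2, pow_add, smul_smul, mul_comm]

lemma derMat_of_mem {n : ℕ} {a : FreeCGA deg} (ha : a ∈ gr deg n) :
    derMat dg hdg a 0 0 = (-1 : ℚ) ^ n • a ∧ derMat dg hdg a 1 0 = 0 ∧ derMat dg hdg a 1 1 = a := by
  induction ha using Submodule.span_induction with
  | zero => simp
  | add x y _ _ hx hy => simp [hx, hy]
  | smul c x _ hx => simp [hx, smul_comm c]
  | mem x hx =>
    obtain ⟨l, rfl, rfl⟩ := hx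
    exact derMat_mon dg hdg l

lemma induction_on {p : FreeCGA deg → Prop} (h : ∀ n, ∀ a ∈ gr deg n, p a)
    (hadd : ∀ a b, p a → p b → p (a + b)) (a : FreeCGA deg) : p a := by
  have ha : a ∈ ⨆ i, gr deg i := by
    rw [(DirectSum.Decomposition.isInternal (gr deg)).submodule_iSup_eq_top]; trivial
  exact Submodule.iSup_induction (gr deg) (motive := p) ha h (h 0 0 (zero_mem _)) hadd

lemma der_mul {n : ℕ} {a : FreeCGA deg} (b : FreeCGA deg) (ha : a ∈ gr deg n) :
    der dg hdg (a * b) = der dg hdg a * b + (-1 : ℚ) ^ n • (a * der dg hdg b) := by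
  have hb : derMat dg hdg b 1 1 = b := by
    induction b using induction_on with
    | h n b hb => exact (derMat_of_mem dg hdg hb).2.2
    | hadd b b' h h' => simp [h, h']
  have h := derMat_of_mem dg hdg ha
  simp [der, Matrix.mul_apply, Fin.sum_univ_two, h.1, hb, add_comm]

lemma der_mem {n : ℕ} {a : FreeCGA deg} (ha : a ∈ gr deg n) : der dg hdg a ∈ gr deg (n + 1) := by
  induction ha using Submodule.span_induction with
  | zero => simp
  | add x y _ _ hx hy => rw [map_add]; exact add_mem hx hy
  | smul c x _ hx => rw [map_smul]; exact Submodule.smul_mem _ _ hx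
  | mem x hx =>
    obtain ⟨l, rfl, rfl⟩ := hx
    induction l with
    | nil => simp [mon, der]
    | cons i l ih =>
      have e : mon deg (i :: l) = ι deg i * mon deg l := by simp [mon]
      have e' : wt deg (i :: l) = deg i + wt deg l := by simp [wt]
      rw [e, e', der_mul dg hdg _ (ι_mem i), der_ι]
      refine add_mem ?_ (Submodule.smul_mem _ _ ?_)
      · convert SetLike.GradedMul.mul_mem (hdg i) (mon_mem l) using 2; ring
      · convert SetLike.GradedMul.mul_mem (ι_mem i) ih using 2; ring

lemma der_der (h : ∀ i, der dg hdg (dg i) = 0) (a : FreeCGA deg) :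
    der dg hdg (der dg hdg a) = 0 := by
  induction a using induction_on with
  | hadd a b ha hb => simp [ha, hb]
  | h n a ha =>
    induction ha using Submodule.span_induction with
    | zero => simp
    | add x y _ _ hx hy => simp [hx, hy]
    | smul c x _ hx => simp [hx]
    | mem x hx =>
      obtain ⟨l, rfl, rfl⟩ := hx
      induction l with
      | nil => simp [mon, der]
      | cons i l ih =>
        have e : mon deg (i :: l) = ι deg i * mon deg l := by simp [mon]
        rw [e, der_mul dg hdg _ (ι_mem i), der_ι, map_add, map_smul, der_mul dg hdg _ (hdg i),
          der_mul dg hdg _ (ι_mem i), der_ι, h, ih, pow_succ]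
        simp

/-- The CDGA `(ΛW, d)` with `d` given on generators. -/
def toCDGA (h : ∀ i, der dg hdg (dg i) = 0) : CDGA.{u} where
  carrier := FreeCGA deg
  gr := gr deg
  mul_comm' := graded_comm
  d := der dg hdg
  d_mem := der_mem dg hdg
  d_d := der_der dg hdg h
  leibniz := der_mul dg hdg

end Derivation

end FreeCGA

/-! ### Minimal Sullivan algebras and connectivity -/

namespace CDGA

/-- The morphism `ΛW → A` extending a choice of homogeneous elements of `A`. -/
def ofGens (A : CDGA.{u}) {I : Type v} {deg : I → ℕ} (g : I → A) (hg : ∀ i, g i ∈ A.gr (deg i)) :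
    FreeCGA deg →ₐ[ℚ] A :=
  FreeCGA.lift g fun i j => A.mul_comm' (hg i) (hg j)

/-- `A` is a (simply connected, finite type) minimal Sullivan algebra. -/
def IsMinimalSullivan (A : CDGA.{u}) : Prop :=
  ∃ (I : Type u) (deg : I → ℕ) (g : I → A) (hg : ∀ i, g i ∈ A.gr (deg i)),
    -- `W` is simply connected and finite-dimensional in each degree
    (∀ i, 2 ≤ deg i) ∧ (∀ m, {i | deg i = m}.Finite) ∧
    -- `A = ΛW` as a commutative graded algebra
    Function.Bijective (A.ofGens g hg) ∧
    -- nilpotence: `d W(k) ⊆ ΛW(k-1)` for an exhaustive increasing filtration of `W`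
    (∃ r : I → ℕ, ∀ i, A.d (g i) ∈ Algebra.adjoin ℚ (g '' {j | r j < r i})) ∧
    -- minimality: `d W ⊆ Λ^{≥ 2} W`
    (∀ i, A.d (g i) ∈ Submodule.span ℚ {a | ∃ l : List I, 2 ≤ l.length ∧ a = (l.map g).prod})

/-- `A` is `r`-connected: `H⁰(A) = ℚ` and `Hⁱ(A) = 0` for `1 ≤ i ≤ r`. -/
def IsConnected (A : CDGA.{u}) (r : ℕ) : Prop :=
  (1 : A) ≠ 0 ∧ (∀ a ∈ A.gr 0, A.d a = 0 → ∃ c : ℚ, a = c • (1 : A)) ∧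
    ∀ i, i < r → ∀ a ∈ A.gr (i + 1), A.d a = 0 → ∃ b ∈ A.gr i, A.d b = a

/-! ### The path object `A ⊗ Λ(t, dt)` and homotopy -/

/-- Apply a linear map to the coefficients of a polynomial. -/
def coeffMap {A : Type u} {B : Type v} [Ring A] [Algebra ℚ A] [Ring B] [Algebra ℚ B]
    (f : A →ₗ[ℚ] B) : A[X] →ₗ[ℚ] B[X] where
  toFun p := p.sum fun n a => Polynomial.monomial n (f a)
  map_add' p q := Polynomial.sum_add_index _ _ _ (by simp) (by simp)
  map_smul' c p := by
    rw [Polynomial.sum_smul_index' _ _ _ (by simp)]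
    simp only [Polynomial.sum, Finset.smul_sum, Polynomial.smul_monomial, map_smul,
      RingHom.id_apply]

@[simp]
lemma coeff_coeffMap {A : Type u} {B : Type v} [Ring A] [Algebra ℚ A] [Ring B] [Algebra ℚ B]
    (f : A →ₗ[ℚ] B) (p : A[X]) (n : ℕ) : (coeffMap f p).coeff n = f (p.coeff n) := by
  simp only [coeffMap, LinearMap.coe_mk, AddHom.coe_mk, Polynomial.sum, Polynomial.finsetSum_coeff,
    Polynomial.coeff_monomial]
  rw [Finset.sum_ite_eq' p.support n]
  split_ifs with h
  · rfl
  · rw [Polynomial.notMem_support_iff.1 h, map_zero]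

/-- The underlying vector space of `A ⊗ Λ(t, dt)`, where `|t| = 0` and `d t = dt`: the pair `(p, q)`
of polynomials in `t` with coefficients in `A` stands for `p + q dt`. -/
def PathAlg (A : CDGA.{u}) : Type u := A[X] × A[X]

namespace PathAlg

variable {A : CDGA.{u}}

instance : AddCommGroup (PathAlg A) := inferInstanceAs (AddCommGroup (A[X] × A[X]))

instance : Module ℚ (PathAlg A) := inferInstanceAs (Module ℚ (A[X] × A[X]))

/-- The degree involution on coefficients. -/
def sgn (A : CDGA.{u}) : A[X] →ₐ[ℚ] A[X] := Polynomial.mapAlgHom A.sign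

@[simp] lemma coeff_sgn (p : A[X]) (n : ℕ) : (sgn A p).coeff n = A.sign (p.coeff n) := by
  simp [sgn]

@[ext] lemma ext {x y : PathAlg A} (h : x.1 = y.1) (h' : x.2 = y.2) : x = y := Prod.ext h h'

/-- The element `p + q dt`. -/
def mk (p q : A[X]) : PathAlg A := (p, q)

@[simp] lemma fst_mk (p q : A[X]) : (mk p q).1 = p := rfl
@[simp] lemma snd_mk (p q : A[X]) : (mk p q).2 = q := rfl
@[simp] lemma fst_add (x y : PathAlg A) : (x + y).1 = x.1 + y.1 := rfl
@[simp] lemma snd_add (x y : PathAlg A) : (x + y).2 = x.2 + y.2 := rfl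
@[simp] lemma fst_zero : (0 : PathAlg A).1 = 0 := rfl
@[simp] lemma snd_zero : (0 : PathAlg A).2 = 0 := rfl
@[simp] lemma fst_smul (c : ℚ) (x : PathAlg A) : (c • x).1 = c • x.1 := rfl
@[simp] lemma snd_smul (c : ℚ) (x : PathAlg A) : (c • x).2 = c • x.2 := rfl

/-- `(p + q dt) (p' + q' dt) = p p' + (p q' + q (sgn p')) dt`, since `dt · a = (-1)^|a| a · dt`. -/
instance : Mul (PathAlg A) := ⟨fun x y => mk (x.1 * y.1) (x.1 * y.2 + x.2 * sgn A y.1)⟩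

instance : One (PathAlg A) := ⟨mk 1 0⟩

@[simp] lemma fst_mul (x y : PathAlg A) : (x * y).1 = x.1 * y.1 := rfl
@[simp] lemma snd_mul (x y : PathAlg A) : (x * y).2 = x.1 * y.2 + x.2 * sgn A y.1 := rfl
@[simp] lemma fst_one : (1 : PathAlg A).1 = 1 := rfl
@[simp] lemma snd_one : (1 : PathAlg A).2 = 0 := rfl

instance : Ring (PathAlg A) where
  __ := (inferInstance : AddCommGroup (PathAlg A))
  left_distrib _ _ _ := by ext1 <;> simp [mul_add]; abel
  right_distrib _ _ _ := by ext1 <;> simp [add_mul]; abel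
  zero_mul _ := by ext1 <;> simp
  mul_zero _ := by ext1 <;> simp
  mul_assoc _ _ _ := by ext1 <;> simp [mul_assoc, mul_add, add_mul, add_assoc]
  one_mul _ := by ext1 <;> simp
  mul_one _ := by ext1 <;> simp

instance : Algebra ℚ (PathAlg A) :=
  Algebra.ofModule (fun _ _ _ => by ext1 <;> simp [smul_add])
    (fun _ _ _ => by ext1 <;> simp [smul_add])

/-- The elements of degree `n - 1` of `A`. -/
def shiftGr (A : CDGA.{u}) : ℕ → Submodule ℚ A
  | 0 => ⊥
  | m + 1 => A.gr m

/-- The elements of degree `n`: `p + q dt` with the coefficients of `p` in degree `n` and those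
of `q` in degree `n - 1`. -/
def gr (A : CDGA.{u}) (n : ℕ) : Submodule ℚ (PathAlg A) where
  carrier := {x | ∀ k, x.1.coeff k ∈ A.gr n ∧ x.2.coeff k ∈ shiftGr A n}
  zero_mem' := by simp
  add_mem' hx hy k := by
    simpa using ⟨add_mem (hx k).1 (hy k).1, add_mem (hx k).2 (hy k).2⟩
  smul_mem' c x hx k := by
    simpa using ⟨Submodule.smul_mem _ c (hx k).1, Submodule.smul_mem _ c (hx k).2⟩

/-- The element `a t^k`. -/
def mk₀ (k : ℕ) (a : A) : PathAlg A := mk (Polynomial.monomial k a) 0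

/-- The element `a t^k dt`. -/
def mk₁ (k : ℕ) (a : A) : PathAlg A := mk 0 (Polynomial.monomial k a)

lemma mk₀_mem {n : ℕ} {a : A} (k : ℕ) (h : a ∈ A.gr n) : mk₀ k a ∈ gr A n := by
  intro j
  simp only [mk₀, fst_mk, snd_mk, Polynomial.coeff_monomial]
  refine ⟨?_, by simp⟩
  split_ifs
  exacts [h, zero_mem _]

lemma mk₁_mem {n : ℕ} {a : A} (k : ℕ) (h : a ∈ A.gr n) : mk₁ k a ∈ gr A (n + 1) := by
  intro j
  simp only [mk₁, fst_mk, snd_mk, Polynomial.coeff_monomial]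
  refine ⟨by simp, ?_⟩
  split_ifs
  exacts [h, zero_mem _]

lemma hom_induction {p : PathAlg A → Prop} (h₀ : ∀ n k, ∀ a ∈ A.gr n, p (mk₀ k a))
    (h₁ : ∀ n k, ∀ a ∈ A.gr n, p (mk₁ k a)) (hadd : ∀ x y, p x → p y → p (x + y))
    (x : PathAlg A) : p x := by
  have H₀ : ∀ f : A[X], p (mk f 0) := by
    intro f
    induction f using Polynomial.induction_on' with
    | add f f' h h' =>
      have e : mk (f + f') 0 = mk f 0 + mk f' 0 := by apply PathAlg.ext <;> simp
      rw [e]; exact hadd _ _ h h'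
    | monomial k a =>
      change p (mk₀ k a)
      induction a using A.gr_induction with
      | h n a ha => exact h₀ n k a ha
      | hadd a b ha hb =>
        have e : mk₀ k (a + b) = mk₀ k a + mk₀ k b := by
          apply PathAlg.ext <;> simp [mk₀]
        rw [e]; exact hadd _ _ ha hb
  have H₁ : ∀ f : A[X], p (mk 0 f) := by
    intro f
    induction f using Polynomial.induction_on' with
    | add f f' h h' =>
      have e : mk 0 (f + f') = mk 0 f + mk 0 f' := by apply PathAlg.ext <;> simp
      rw [e]; exact hadd _ _ h h'
    | monomial k a =>
      change p (mk₁ k a)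
      induction a using A.gr_induction with
      | h n a ha => exact h₁ n k a ha
      | hadd a b ha hb =>
        have e : mk₁ k (a + b) = mk₁ k a + mk₁ k b := by
          apply PathAlg.ext <;> simp [mk₁]
        rw [e]; exact hadd _ _ ha hb
  have e : x = mk x.1 0 + mk 0 x.2 := by apply PathAlg.ext <;> simp
  rw [e]
  exact hadd _ _ (H₀ _) (H₁ _)

lemma iSup_gr : ⨆ n, gr A n = ⊤ := by
  rw [eq_top_iff]
  rintro x -
  induction x using hom_induction with
  | h₀ n k a ha => exact Submodule.mem_iSup_of_mem n (mk₀_mem k ha)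
  | h₁ n k a ha => exact Submodule.mem_iSup_of_mem (n + 1) (mk₁_mem k ha)
  | hadd x y hx hy => exact add_mem hx hy

/-- The projection of `A` onto its degree `n - 1` part. -/
def shiftProj (A : CDGA.{u}) : ℕ → (A →ₗ[ℚ] A)
  | 0 => 0
  | m + 1 => GradedAlgebra.proj A.gr m

/-- The projection onto the degree `n` part. -/
def proj (A : CDGA.{u}) (n : ℕ) : PathAlg A →ₗ[ℚ] PathAlg A :=
  LinearMap.prodMap (coeffMap (GradedAlgebra.proj A.gr n)) (coeffMap (shiftProj A n))

lemma proj_same {n : ℕ} {x : PathAlg A} (h : x ∈ gr A n) : proj A n x = x := by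
  apply PathAlg.ext <;> ext k
  · change (coeffMap (GradedAlgebra.proj A.gr n) x.1).coeff k = _
    rw [coeff_coeffMap, GradedAlgebra.proj_apply, DirectSum.decompose_of_mem_same _ (h k).1]
  · change (coeffMap (shiftProj A n) x.2).coeff k = _
    rw [coeff_coeffMap]
    have h2 := (h k).2
    cases n with
    | zero => exact ((Submodule.mem_bot ℚ).1 h2).symm
    | succ m => exact DirectSum.decompose_of_mem_same _ h2

lemma proj_ne {m n : ℕ} (hmn : m ≠ n) {x : PathAlg A} (h : x ∈ gr A m) : proj A n x = 0 := by
  apply PathAlg.ext <;> ext k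
  · change (coeffMap (GradedAlgebra.proj A.gr n) x.1).coeff k = _
    rw [coeff_coeffMap, GradedAlgebra.proj_apply, DirectSum.decompose_of_mem_ne _ (h k).1 hmn]
    rfl
  · change (coeffMap (shiftProj A n) x.2).coeff k = 0
    rw [coeff_coeffMap]
    have h2 := (h k).2
    cases n with
    | zero => rfl
    | succ n =>
      cases m with
      | zero => rw [(Submodule.mem_bot ℚ).1 h2, map_zero]
      | succ m => exact DirectSum.decompose_of_mem_ne _ h2 (by omega)

lemma iSupIndep_gr : iSupIndep (gr A) := by
  intro n
  rw [Submodule.disjoint_def]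
  intro x hx hx'
  have hle : ⨆ j, ⨆ (_ : j ≠ n), gr A j ≤ LinearMap.ker (proj A n) :=
    iSup₂_le fun j hj y hy => proj_ne hj hy
  rw [← proj_same hx]
  exact hle hx'

lemma sum_coeff_mem {p q : A[X]} {S : Submodule ℚ A} (h : ∀ i j, p.coeff i * q.coeff j ∈ S)
    (k : ℕ) : (p * q).coeff k ∈ S := by
  rw [Polynomial.coeff_mul]
  exact sum_mem fun c _ => h _ _

lemma sign_mem {n : ℕ} {a : A} (h : a ∈ A.gr n) : A.sign a ∈ A.gr n := by
  rw [A.sign_of_mem h]; exact Submodule.smul_mem _ _ h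

instance : SetLike.GradedMonoid (gr A) where
  one_mem k := by
    refine ⟨?_, by simp⟩
    rw [fst_one, Polynomial.coeff_one]
    split_ifs
    exacts [SetLike.GradedOne.one_mem, zero_mem _]
  mul_mem := by
    intro m n x y hx hy k
    refine ⟨sum_coeff_mem (fun i j => SetLike.GradedMul.mul_mem (hx i).1 (hy j).1) k, ?_⟩
    rw [snd_mul, Polynomial.coeff_add]
    refine add_mem (sum_coeff_mem (fun i j => ?_) k) (sum_coeff_mem (fun i j => ?_) k)
    · have h1 := (hx i).1
      have h2 := (hy j).2
      cases n with
      | zero => rw [(Submodule.mem_bot ℚ).1 h2, mul_zero]; exact zero_mem _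
      | succ n => exact SetLike.GradedMul.mul_mem (A := A.gr) h1 h2
    · have h1 := (hx i).2
      have h2 := sign_mem (hy j).1
      rw [coeff_sgn]
      cases m with
      | zero => rw [(Submodule.mem_bot ℚ).1 h1, zero_mul]; exact zero_mem _
      | succ m =>
        rw [Nat.succ_add]
        exact SetLike.GradedMul.mul_mem (A := A.gr) h1 h2

instance : GradedAlgebra (gr A) where
  __ := (inferInstance : SetLike.GradedMonoid (gr A))
  __ := (DirectSum.isInternal_submodule_of_iSupIndep_of_iSup_eq_top
    iSupIndep_gr iSup_gr).chooseDecomposition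

lemma poly_comm {i j : ℕ} {p q : A[X]} (hp : ∀ k, p.coeff k ∈ A.gr i)
    (hq : ∀ k, q.coeff k ∈ A.gr j) : p * q = (-1 : ℚ) ^ (i * j) • (q * p) := by
  ext k
  rw [Polynomial.coeff_smul, Polynomial.coeff_mul, Polynomial.coeff_mul, Finset.smul_sum,
    ← Finset.Nat.sum_antidiagonal_swap]
  exact Finset.sum_congr rfl fun c _ => A.mul_comm' (hp _) (hq _)

lemma sgn_of_mem {i : ℕ} {p : A[X]} (hp : ∀ k, p.coeff k ∈ A.gr i) :
    sgn A p = (-1 : ℚ) ^ i • p := by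
  ext k
  rw [coeff_sgn, A.sign_of_mem (hp k), Polynomial.coeff_smul]

lemma graded_comm {i j : ℕ} {x y : PathAlg A} (hx : x ∈ gr A i) (hy : y ∈ gr A j) :
    x * y = (-1 : ℚ) ^ (i * j) • (y * x) := by
  apply PathAlg.ext
  · exact poly_comm (fun k => (hx k).1) (fun k => (hy k).1)
  · rw [snd_mul, snd_smul, snd_mul, add_comm, smul_add,
      sgn_of_mem (fun k => (hx k).1), sgn_of_mem (fun k => (hy k).1)]
    congr 1
    · cases i with
      | zero =>
        have : x.2 = 0 := by ext k; exact (Submodule.mem_bot ℚ).1 (hx k).2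
        simp [this]
      | succ i =>
        rw [mul_smul_comm, poly_comm (p := x.2) (fun k => (hx k).2) (fun k => (hy k).1),
          smul_smul, ← pow_add]
        congr 2; ring
    · cases j with
      | zero =>
        have : y.2 = 0 := by ext k; exact (Submodule.mem_bot ℚ).1 (hy k).2
        simp [this]
      | succ j =>
        rw [mul_smul_comm, poly_comm (q := y.2) (fun k => (hx k).1) (fun k => (hy k).2),
          smul_smul, ← pow_add]
        congr 1
        rw [mul_add, mul_one, add_assoc, pow_add, ← two_mul, pow_mul _ 2]
        simp

/-- The differential on coefficients. -/
abbrev D (A : CDGA.{u}) : A[X] →ₗ[ℚ] A[X] := coeffMap A.d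

lemma D_mul (p q : A[X]) : D A (p * q) = D A p * q + sgn A p * D A q := by
  ext k
  simp [Polynomial.coeff_mul, A.d_mul, Finset.sum_add_distrib]

lemma D_sgn (p : A[X]) : D A (sgn A p) = - sgn A (D A p) := by
  ext k
  simp [A.d_sign]

lemma D_derivative (p : A[X]) : D A (Polynomial.derivative p) = Polynomial.derivative (D A p) := by
  ext k
  have h : ∀ a : A, a * ((k : A) + 1) = ((k : ℚ) + 1) • a := by
    intro a
    rw [Algebra.smul_def, map_add, map_natCast, map_one]
    exact (((Nat.cast_commute k a).add_left (Commute.one_left a)).symm)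
  simp only [coeff_coeffMap, Polynomial.coeff_derivative, h, map_smul]

/-- `d (p + q dt) = d p + (sgn p' + d q) dt`, as `d (a t^k) = (d a) t^k + (-1)^|a| k a t^(k-1) dt`. -/
def d (A : CDGA.{u}) : PathAlg A →ₗ[ℚ] PathAlg A where
  toFun x := mk (D A x.1) (sgn A (Polynomial.derivative x.1) + D A x.2)
  map_add' x y := by apply PathAlg.ext <;> simp; abel
  map_smul' c x := by
    apply PathAlg.ext <;> simp [smul_add]

@[simp] lemma fst_d (x : PathAlg A) : (d A x).1 = D A x.1 := rfl
@[simp] lemma snd_d (x : PathAlg A) :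
    (d A x).2 = sgn A (Polynomial.derivative x.1) + D A x.2 := rfl

lemma D_D (p : A[X]) : D A (D A p) = 0 := by
  ext k
  simp [A.d_d]

lemma d_d (x : PathAlg A) : d A (d A x) = 0 := by
  apply PathAlg.ext
  · simp [D_D]
  · simp only [snd_d, fst_d, map_add, D_sgn, D_D, D_derivative, snd_zero]
    abel

lemma d_mem {i : ℕ} {x : PathAlg A} (hx : x ∈ gr A i) : d A x ∈ gr A (i + 1) := by
  intro k
  refine ⟨by simpa using A.d_mem (hx k).1, ?_⟩
  rw [snd_d, Polynomial.coeff_add, coeff_sgn, coeff_coeffMap]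
  refine add_mem ?_ ?_
  · apply sign_mem
    rw [Polynomial.coeff_derivative, ← Nat.cast_add_one, ← nsmul_eq_mul']
    exact nsmul_mem (hx (k + 1)).1 _
  · have h := (hx k).2
    cases i with
    | zero => rw [(Submodule.mem_bot ℚ).1 h, map_zero]; exact zero_mem _
    | succ i => exact A.d_mem h

lemma leibniz {i : ℕ} {x : PathAlg A} (y : PathAlg A) (hx : x ∈ gr A i) :
    d A (x * y) = d A x * y + (-1 : ℚ) ^ i • (x * d A y) := by
  have h1 : (-1 : ℚ) ^ i • x.1 = sgn A x.1 := (sgn_of_mem fun k => (hx k).1).symm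
  have h2 : (-1 : ℚ) ^ i • x.2 = - sgn A x.2 := by
    cases i with
    | zero =>
      have : x.2 = 0 := by ext k; exact (Submodule.mem_bot ℚ).1 (hx k).2
      simp [this]
    | succ i => rw [sgn_of_mem (p := x.2) fun k => (hx k).2, pow_succ]; simp
  rw [← smul_mul_assoc]
  apply PathAlg.ext
  · simp only [fst_d, fst_mul, fst_add, fst_smul, h1, D_mul]
  · simp only [fst_d, fst_mul, fst_smul, snd_d, snd_mul, snd_add, snd_smul, h1, h2, D_mul,
      Polynomial.derivative_mul, map_add, map_mul, D_sgn]
    simp only [mul_add, add_mul, neg_mul, mul_neg]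
    abel

end PathAlg

/-- The path object `A ⊗ Λ(t, dt)`. -/
def path (A : CDGA.{u}) : CDGA.{u} where
  carrier := PathAlg A
  gr := PathAlg.gr A
  mul_comm' := PathAlg.graded_comm
  d := PathAlg.d A
  d_mem := PathAlg.d_mem
  d_d := PathAlg.d_d
  leibniz := PathAlg.leibniz

/-- Evaluation `A ⊗ Λ(t, dt) → A` at `t = 0`, `dt = 0`. -/
def ev₀ {A : CDGA.{u}} (x : PathAlg A) : A := x.1.eval 0

/-- Evaluation `A ⊗ Λ(t, dt) → A` at `t = 1`, `dt = 0`. -/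
def ev₁ {A : CDGA.{u}} (x : PathAlg A) : A := x.1.eval 1

/-- Two morphisms are homotopic if they are the end points of a morphism `A → B ⊗ Λ(t, dt)`. -/
def Homotopic {A : CDGA.{u}} {B : CDGA.{v}} (f g : Hom A B) : Prop :=
  ∃ H : Hom A B.path, ∀ a : A,
    ev₀ (H.toAlgHom a) = f.toAlgHom a ∧ ev₁ (H.toAlgHom a) = g.toAlgHom a

/-- Composition of morphisms. -/
def Hom.comp {A B C : CDGA.{u}} (f : Hom B C) (g : Hom A B) : Hom A C :=
  ⟨f.toAlgHom.comp g.toAlgHom, fun h => f.map_gr (g.map_gr h), fun a => by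
    rw [AlgHom.comp_apply, AlgHom.comp_apply, g.map_d, f.map_d]⟩

/-- The morphism `f ⊗ id` on `A ⊗ Λ(t, dt)`. -/
def Hom.path {A B : CDGA.{u}} (f : Hom A B) : Hom A.path B.path where
  toAlgHom := AlgHom.ofLinearMap (A := PathAlg A) (B := PathAlg B)
    { toFun := fun x => PathAlg.mk (Polynomial.mapAlgHom f.toAlgHom x.1)
        (Polynomial.mapAlgHom f.toAlgHom x.2)
      map_add' := fun x y => by apply PathAlg.ext <;> simp
      map_smul' := fun c x => by
        apply PathAlg.ext
        · exact map_smul (Polynomial.mapAlgHom f.toAlgHom) c x.1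
        · exact map_smul (Polynomial.mapAlgHom f.toAlgHom) c x.2 }
    (by apply PathAlg.ext <;> simp)
    (fun x y => by
      have h : Polynomial.mapAlgHom f.toAlgHom (PathAlg.sgn A y.1) =
          PathAlg.sgn B (Polynomial.mapAlgHom f.toAlgHom y.1) := by
        ext k
        simp [f.map_sign]
      apply PathAlg.ext
      · exact map_mul _ _ _
      · change Polynomial.mapAlgHom f.toAlgHom (x.1 * y.2 + x.2 * PathAlg.sgn A y.1) = _
        rw [map_add, map_mul, map_mul, h]
        rfl)
  map_gr := by
    intro n x hx k
    refine ⟨?_, ?_⟩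
    · change (Polynomial.mapAlgHom f.toAlgHom (x : PathAlg A).1).coeff k ∈ _
      rw [Polynomial.coe_mapAlgHom, Polynomial.coeff_map]
      exact f.map_gr (hx k).1
    · change (Polynomial.mapAlgHom f.toAlgHom (x : PathAlg A).2).coeff k ∈ _
      rw [Polynomial.coe_mapAlgHom, Polynomial.coeff_map]
      have h := (hx k).2
      cases n with
      | zero => rw [(Submodule.mem_bot ℚ).1 h, map_zero]; exact zero_mem _
      | succ n => exact f.map_gr h
  map_d := by
    intro x
    have hD : ∀ p : A[X], Polynomial.mapAlgHom f.toAlgHom (PathAlg.D A p) =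
        PathAlg.D B (Polynomial.mapAlgHom f.toAlgHom p) := by
      intro p
      ext k
      simp [f.map_d]
    apply PathAlg.ext
    · exact hD _
    · change Polynomial.mapAlgHom f.toAlgHom
          (PathAlg.sgn A (Polynomial.derivative (x : PathAlg A).1) + PathAlg.D A (x : PathAlg A).2) =
        PathAlg.sgn B (Polynomial.derivative (Polynomial.mapAlgHom f.toAlgHom (x : PathAlg A).1)) +
          PathAlg.D B (Polynomial.mapAlgHom f.toAlgHom (x : PathAlg A).2)
      rw [map_add, hD]
      congr 1
      ext k
      simp [f.map_sign]

lemma ev₀_map {A B : CDGA.{u}} (f : Hom A B) (x : PathAlg A) :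
    Polynomial.eval 0 (Polynomial.map (f.toAlgHom : A →+* B) x.1) = f.toAlgHom (ev₀ x) := by
  rw [← map_zero (f.toAlgHom : A →+* B), Polynomial.eval_map_apply]
  rfl

lemma ev₁_map {A B : CDGA.{u}} (f : Hom A B) (x : PathAlg A) :
    Polynomial.eval 1 (Polynomial.map (f.toAlgHom : A →+* B) x.1) = f.toAlgHom (ev₁ x) := by
  rw [← map_one (f.toAlgHom : A →+* B), Polynomial.eval_map_apply]
  rfl

lemma Homotopic.comp_left {A B C : CDGA.{u}} {f g : Hom A B} (h : Homotopic f g) (k : Hom B C) :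
    Homotopic (k.comp f) (k.comp g) := by
  obtain ⟨H, hH⟩ := h
  refine ⟨k.path.comp H, fun a => ⟨?_, ?_⟩⟩
  · exact (ev₀_map k (H.toAlgHom a)).trans (congrArg k.toAlgHom (hH a).1)
  · exact (ev₁_map k (H.toAlgHom a)).trans (congrArg k.toAlgHom (hH a).2)

lemma Homotopic.comp_right {A B C : CDGA.{u}} {f g : Hom B C} (h : Homotopic f g) (k : Hom A B) :
    Homotopic (f.comp k) (g.comp k) := by
  obtain ⟨H, hH⟩ := h
  exact ⟨H.comp k, fun a => hH (k.toAlgHom a)⟩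

/-- The equivalence relation on `End A` generated by homotopy, as a congruence for composition.
For `A` a Sullivan algebra, homotopy is already an equivalence relation. -/
def homotopyCon (A : CDGA.{u}) : Con (End A) where
  toSetoid := Relation.EqvGen.setoid Homotopic
  mul' := by
    intro f f' g g' hf hg
    have h1 : Relation.EqvGen Homotopic (f * g) (f' * g) := by
      induction hf with
      | rel _ _ h => exact .rel _ _ (h.comp_right g)
      | refl _ => exact .refl _
      | symm _ _ _ ih => exact .symm _ _ ih
      | trans _ _ _ _ _ ih ih' => exact .trans _ _ _ ih ih'
    have h2 : Relation.EqvGen Homotopic (f' * g) (f' * g') := by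
      clear h1 hf
      induction hg with
      | rel _ _ h => exact .rel _ _ (h.comp_left f')
      | refl _ => exact .refl _
      | symm _ _ _ ih => exact .symm _ _ ih
      | trans _ _ _ _ _ ih ih' => exact .trans _ _ _ ih ih'
    exact .trans _ _ _ h1 h2

/-- The monoid `[A, A]` of homotopy classes of self-maps of `A`. -/
abbrev HomotopyClasses (A : CDGA.{u}) : Type u := A.homotopyCon.Quotient

/-- The group `ℰ(A)` of homotopy classes of self-homotopy equivalences of `A`: the classes in
`[A, A]` having an inverse under composition. -/
abbrev SelfEquiv (A : CDGA.{u}) : Type u := (HomotopyClasses A)ˣ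

end CDGA

/-! ### The algebras `M_n(𝒢)` -/

/-- The generators of `M_n(𝒢)`, for `𝒢` with vertex set `V`. -/
inductive Gen (V : Type u) : Type u
  | x₁ | x₂ | y₁ | y₂ | y₃ | z
  | x (v : V)
  | zv (v : V)

namespace Gen

variable {V : Type u} (n : ℕ)

/-- The degrees of the generators. -/
def deg : Gen V → ℕ
  | x₁ => 30 * n + 18
  | x₂ => 36 * n + 22
  | y₁ => 126 * n + 75
  | y₂ => 132 * n + 79
  | y₃ => 138 * n + 83
  | z => 540 * n ^ 2 + 654 * n + 197
  | x _ => 180 * n ^ 2 + 218 * n + 66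
  | zv _ => 540 * n ^ 2 + 654 * n + 197

/-- The generators as elements of the free commutative graded algebra. -/
abbrev el (g : Gen V) : FreeCGA (deg (V := V) n) := FreeCGA.ι (deg n) g

lemma pow_mem (g : Gen V) (k : ℕ) : el n g ^ k ∈ FreeCGA.gr (deg (V := V) n) (k * deg n g) :=
  SetLike.pow_mem_graded k (FreeCGA.ι_mem g)

lemma comm_of_even {g : Gen V} (hg : Even (deg n g)) (h : Gen V) :
    el n h * el n g = el n g * el n h := by
  rw [FreeCGA.ι_mul_ι, (hg.mul_left _).neg_one_pow, one_smul]

lemma aux_ring {R : Type u} [Ring R] {a b p q r : R} (hab : b * a = a * b)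
    (pa : p * a = a * p) (pb : p * b = b * p) (qa : q * a = a * q) (qb : q * b = b * q) :
    a ^ 2 * (a ^ 2 * b ^ 2) * r - a ^ 2 * q * (a * b ^ 3)
      - (a * b * (a ^ 3 * b) * r - a * b * p * (a * b ^ 3))
      + (b ^ 2 * (a ^ 3 * b) * q - b ^ 2 * p * (a ^ 2 * b ^ 2)) = 0 := by
  have hab' (c : R) : b * (a * c) = a * (b * c) := by rw [← mul_assoc, hab, mul_assoc]
  have pa' (c : R) : p * (a * c) = a * (p * c) := by rw [← mul_assoc, pa, mul_assoc]
  have pb' (c : R) : p * (b * c) = b * (p * c) := by rw [← mul_assoc, pb, mul_assoc]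
  have qa' (c : R) : q * (a * c) = a * (q * c) := by rw [← mul_assoc, qa, mul_assoc]
  have qb' (c : R) : q * (b * c) = b * (q * c) := by rw [← mul_assoc, qb, mul_assoc]
  simp only [pow_succ, pow_zero, one_mul, mul_assoc, hab', pa', pb, pb', qa', qb, qb']
  abel

variable [Fintype V] (G : SimpleGraph V) [DecidableRel G.Adj]

/-- The differential on generators. -/
def dGen : Gen V → FreeCGA (deg (V := V) n)
  | x₁ => 0
  | x₂ => 0
  | y₁ => el n x₁ ^ 3 * el n x₂
  | y₂ => el n x₁ ^ 2 * el n x₂ ^ 2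
  | y₃ => el n x₁ * el n x₂ ^ 3
  | z => el n x₁ ^ (18 * n) *
      (el n x₁ ^ 2 * el n y₂ * el n y₃ - el n x₁ * el n x₂ * el n y₁ * el n y₃
        + el n x₂ ^ 2 * el n y₁ * el n y₂)
      + el n x₁ ^ (18 * n + 11) + el n x₂ ^ (15 * n + 9)
  | x _ => 0
  | zv v => el n (x v) ^ 3
      + ∑ w ∈ G.neighborFinset v, el n (x v) * el n (x w) * el n x₂ ^ (5 * n + 3)

lemma dGen_mem (g : Gen V) : dGen n G g ∈ FreeCGA.gr (deg (V := V) n) (deg n g + 1) := by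
  have ha {i j : ℕ} {a : FreeCGA (deg (V := V) n)} (h : a ∈ FreeCGA.gr (deg (V := V) n) i)
    (e : i = j) : a ∈ FreeCGA.gr (deg (V := V) n) j := e ▸ h
  have hm {i j : ℕ} {a b : FreeCGA (deg (V := V) n)} (h : a ∈ FreeCGA.gr (deg (V := V) n) i)
    (h' : b ∈ FreeCGA.gr (deg (V := V) n) j) : a * b ∈ FreeCGA.gr (deg (V := V) n) (i + j) :=
    SetLike.GradedMul.mul_mem h h'
  have hp := pow_mem (V := V) n
  have h1 (g : Gen V) : el n g ∈ FreeCGA.gr (deg (V := V) n) (deg n g) := FreeCGA.ι_mem g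
  cases g with
  | x₁ => exact zero_mem _
  | x₂ => exact zero_mem _
  | x v => exact zero_mem _
  | y₁ => exact ha (hm (hp _ _) (h1 _)) (by simp only [deg]; ring)
  | y₂ => exact ha (hm (hp _ _) (hp _ _)) (by simp only [deg]; ring)
  | y₃ => exact ha (hm (h1 _) (hp _ _)) (by simp only [deg]; ring)
  | z =>
    refine add_mem (add_mem (ha (hm (hp _ _) (j := 330 * n + 198)
      (add_mem (sub_mem ?_ ?_) ?_)) ?_) (ha (hp _ _) ?_)) (ha (hp _ _) ?_)
    · exact ha (hm (hm (hp _ _) (h1 _)) (h1 _)) (by simp only [deg]; ring)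
    · exact ha (hm (hm (hm (h1 _) (h1 _)) (h1 _)) (h1 _)) (by simp only [deg]; ring)
    · exact ha (hm (hm (hp _ _) (h1 _)) (h1 _)) (by simp only [deg]; ring)
    all_goals simp only [deg]; ring
  | zv v =>
    refine add_mem (ha (hp _ _) (by simp only [deg]; ring)) (sum_mem fun w _ => ?_)
    exact ha (hm (hm (h1 _) (h1 _)) (hp _ _)) (by simp only [deg]; ring)

lemma der_zero_mul {a b : FreeCGA (deg (V := V) n)}
    (ha : FreeCGA.der _ (dGen_mem n G) a = 0) (hb : FreeCGA.der _ (dGen_mem n G) b = 0) :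
    FreeCGA.der _ (dGen_mem n G) (a * b) = 0 := by
  simp only [FreeCGA.der, LinearMap.coe_mk, AddHom.coe_mk] at ha hb
  simp [FreeCGA.der, Matrix.mul_apply, Fin.sum_univ_two, ha, hb]

lemma der_zero_pow {a : FreeCGA (deg (V := V) n)}
    (ha : FreeCGA.der _ (dGen_mem n G) a = 0) (k : ℕ) :
    FreeCGA.der _ (dGen_mem n G) (a ^ k) = 0 := by
  induction k with
  | zero => simp [FreeCGA.der]
  | succ k ih => rw [pow_succ]; exact der_zero_mul n G ih ha

lemma der_dGen (g : Gen V) : FreeCGA.der _ (dGen_mem n G) (dGen n G g) = 0 := by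
  have hι (g : Gen V) : FreeCGA.der _ (dGen_mem n G) (el n g) = dGen n G g := FreeCGA.der_ι _ _ g
  have hx₁ : FreeCGA.der _ (dGen_mem n G) (el n x₁) = 0 := hι x₁
  have hx₂ : FreeCGA.der _ (dGen_mem n G) (el n x₂) = 0 := hι x₂
  have hx (v : V) : FreeCGA.der _ (dGen_mem n G) (el n (x v)) = 0 := hι (x v)
  have hm {a b} := der_zero_mul n G (a := a) (b := b)
  have hp {a} := der_zero_pow n G (a := a)
  have e₁ : Even (deg n (x₁ : Gen V)) := ⟨15 * n + 9, by simp only [deg]; ring⟩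
  have e₂ : Even (deg n (x₂ : Gen V)) := ⟨18 * n + 11, by simp only [deg]; ring⟩
  cases g with
  | x₁ => simp [dGen]
  | x₂ => simp [dGen]
  | x v => simp [dGen]
  | y₁ => exact hm (hp hx₁ _) hx₂
  | y₂ => exact hm (hp hx₁ _) (hp hx₂ _)
  | y₃ => exact hm hx₁ (hp hx₂ _)
  | zv v =>
    simp only [dGen, map_add, map_sum, hp (hx v), zero_add]
    exact Finset.sum_eq_zero fun w _ => hm (hm (hx v) (hx w)) (hp hx₂ _)
  | z =>
    -- `d (c y y') = c (dy) y' - c y (dy')` for an even cocycle `c` and odd generators `y`, `y'`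
    have key {c : FreeCGA (deg (V := V) n)} {k : ℕ} (hc : c ∈ FreeCGA.gr (deg (V := V) n) k)
        (hk : Even k) (hc' : FreeCGA.der _ (dGen_mem n G) c = 0) {g h : Gen V}
        (hg : Odd (deg n g)) : FreeCGA.der _ (dGen_mem n G) (c * el n g * el n h) =
          c * dGen n G g * el n h - c * el n g * dGen n G h := by
      rw [mul_assoc, FreeCGA.der_mul _ _ _ hc, FreeCGA.der_mul _ _ _ (FreeCGA.ι_mem g), hι, hι, hc',
        hk.neg_one_pow, hg.neg_one_pow, zero_mul, zero_add, one_smul, mul_add, mul_smul_comm,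
        neg_one_smul, mul_assoc, mul_assoc, sub_eq_add_neg]
    have o₁ : Odd (deg n (y₁ : Gen V)) := ⟨63 * n + 37, by simp only [deg]; ring⟩
    have o₂ : Odd (deg n (y₂ : Gen V)) := ⟨66 * n + 39, by simp only [deg]; ring⟩
    have hin : FreeCGA.der _ (dGen_mem n G)
        (el n x₁ ^ 2 * el n y₂ * el n y₃ - el n x₁ * el n x₂ * el n y₁ * el n y₃
          + el n x₂ ^ 2 * el n y₁ * el n y₂) = 0 := by
      rw [map_add, map_sub, key (pow_mem n x₁ 2) (e₁.mul_left _) (hp hx₁ _) o₂,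
        key (SetLike.GradedMul.mul_mem (FreeCGA.ι_mem x₁) (FreeCGA.ι_mem x₂)) (e₁.add e₂)
          (hm hx₁ hx₂) o₁, key (pow_mem n x₂ 2) (e₂.mul_left _) (hp hx₂ _) o₁]
      exact aux_ring (comm_of_even n e₁ _) (comm_of_even n e₁ _) (comm_of_even n e₂ _)
        (comm_of_even n e₁ _) (comm_of_even n e₂ _)
    simp only [dGen, map_add, hp hx₁, hp hx₂, add_zero]
    exact hm (hp hx₁ _) hin

end Gen

/-- The CDGA `M_n(𝒢)`. -/
def graphAlgebra {V : Type u} [Fintype V] (n : ℕ) (G : SimpleGraph V) [DecidableRel G.Adj] :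
    CDGA.{u} :=
  FreeCGA.toCDGA (Gen.dGen n G) (Gen.dGen_mem n G) (Gen.der_dGen n G)

end

/-! Put N = 5n+3 and K = 18n+11. Then |x₁| = 6N, |x₂| = 2K, |x_v| = 2KN, |z| = |z_v| = 6KN-1, and 5K
= 18N+1. Since K is coprime to 3N, very few monomials share a degree with a generator (`arith`). So
an endomorphism F scales x₁, x₂, y₁, y₂, y₃ separately, sends x_v to a combination of x₂^N and the
x_w (`gr_x_le`), and sends z and z_v to combinations of z and the z_w (`gr_z_le`).

The same count trivialises homotopy (`eq_of_homotopic`). One degree below a generator other than z,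
z_v the algebra is zero, and one degree below z it consists of cocycles. A homotopy is therefore
constant on generators, homotopy classes are single maps, and a self-equivalence is an honest
automorphism.

Let F be injective, with F x₁ = αx₁ and F x₂ = βx₂, and let c be the coefficient of z in F z.
Comparing F(dz) with d(F z) gives α^(18n+11) = α^(18n+5) β^5 = β^(15n+9) = c, which forces α = β = c
= 1 (`eq_one_of_pow_eq`). Setting x₁ = 0, x₂ = 1 in the equations for z_v leaves a linear
substitution that carries the cubics x_v³ + ∑ x_v x_w to combinations of one another. The cubes
force it to be a permutation up to scalars, the quadratic terms force the permutation to preserve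
adjacency, and edges force the scalars to be 1 (`exists_aut_of_cubic_identity`). So F comes from a
graph automorphism (`exists_autEnd_eq`). -/

noncomputable section

universe u v

/-! ### Monomials up to reordering -/

namespace FreeCGA

variable {I : Type u} {deg : I → ℕ}

lemma gr_le {m : ℕ} {S : Submodule ℚ (FreeCGA deg)}
    (h : ∀ l, wt deg l = m → mon deg l ∈ S) : gr deg m ≤ S :=
  Submodule.span_le.2 (by rintro _ ⟨l, hl, rfl⟩; exact h l hl)

lemma wt_cons (w : I → ℕ) (i : I) (l : List I) : wt w (i :: l) = w i + wt w l := by simp [wt]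

lemma mon_cons (i : I) (l : List I) : mon deg (i :: l) = ι deg i * mon deg l := by simp [mon]

lemma mon_singleton (i : I) : mon deg [i] = ι deg i := by simp [mon]

lemma wt_perm (w : I → ℕ) {l l' : List I} (h : l.Perm l') : wt w l = wt w l' :=
  (h.map w).sum_eq

lemma mon_perm {l l' : List I} (h : l.Perm l') : ∃ c : ℚ, mon deg l = c • mon deg l' := by
  induction h with
  | nil => exact ⟨1, (one_smul _ _).symm⟩
  | cons x _ ih =>
    obtain ⟨c, hc⟩ := ih
    exact ⟨c, by rw [mon_cons, hc, mon_cons, mul_smul_comm]⟩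
  | swap x y l =>
    exact ⟨_, by rw [mon_cons, mon_cons, ← mul_assoc, ι_mul_ι, smul_mul_assoc, mul_assoc,
      ← mon_cons, ← mon_cons]⟩
  | trans _ _ ih ih' =>
    obtain ⟨c, hc⟩ := ih
    obtain ⟨c', hc'⟩ := ih'
    exact ⟨c * c', by rw [hc, hc', smul_smul]⟩

/-- For an indicator function `w`, `wt w l` counts the factors of that kind; a nonzero count lets
one such factor be moved to the front. -/
lemma exists_perm_cons {w : I → ℕ} {l : List I} (h : wt w l ≠ 0) :
    ∃ i l', w i ≠ 0 ∧ l.Perm (i :: l') := by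
  obtain ⟨i, hi, hw⟩ : ∃ i ∈ l, w i ≠ 0 := by
    by_contra! hc
    exact h (List.sum_eq_zero (by simpa using hc))
  obtain ⟨s, t, rfl⟩ := List.append_of_mem hi
  exact ⟨i, s ++ t, hw, List.perm_middle⟩

lemma ι_mul_self {i : I} (hi : Odd (deg i)) : ι deg i * ι deg i = 0 := by
  have h := ι_mul_ι deg i i
  rw [(hi.mul hi).neg_one_pow, neg_one_smul] at h
  have h2 : (2 : ℚ) • (ι deg i * ι deg i) = 0 := by
    rw [two_smul]
    exact add_eq_zero_iff_eq_neg.2 h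
  exact (smul_eq_zero.1 h2).resolve_left two_ne_zero

/-- A monomial in which an odd generator is repeated vanishes. -/
lemma mon_eq_zero {w : I → ℕ} {i : I} (hi : Odd (deg i)) (hw : ∀ j, w j ≠ 0 → j = i)
    (hw' : w i ≤ 1) {l : List I} (h : 2 ≤ wt w l) : mon deg l = 0 := by
  obtain ⟨j, l', hj, hp⟩ := exists_perm_cons (w := w) (l := l) (by omega)
  obtain rfl := hw j hj
  rw [wt_perm w hp, wt_cons] at h
  obtain ⟨k, l'', hk, hp'⟩ := exists_perm_cons (w := w) (l := l') (by omega)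
  obtain rfl := hw k hk
  obtain ⟨c, hc⟩ := mon_perm (deg := deg) (hp.trans (hp'.cons k))
  rw [hc, mon_cons, mon_cons, ← mul_assoc, ι_mul_self hi, zero_mul, smul_zero]

end FreeCGA

/-! ### Counting generators in monomials of low degree -/

namespace Gen

open FreeCGA

variable {V : Type u}

/-- The indicator function of the generator `x₁`. -/
def cX₁ : Gen V → ℕ | x₁ => 1 | _ => 0
/-- The indicator function of the generator `x₂`. -/
def cX₂ : Gen V → ℕ | x₂ => 1 | _ => 0
/-- The indicator function of the generator `y₁`. -/
def cY₁ : Gen V → ℕ | y₁ => 1 | _ => 0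
/-- The indicator function of the generator `y₂`. -/
def cY₂ : Gen V → ℕ | y₂ => 1 | _ => 0
/-- The indicator function of the generator `y₃`. -/
def cY₃ : Gen V → ℕ | y₃ => 1 | _ => 0
/-- The indicator function of the generators `x_v`. -/
def cX : Gen V → ℕ | x _ => 1 | _ => 0
/-- The indicator function of the generators `z` and `z_v`. -/
def cZ : Gen V → ℕ | z => 1 | zv _ => 1 | _ => 0

lemma length_eq (l : List (Gen V)) : l.length = wt cX₁ l + wt cX₂ l + wt cY₁ l + wt cY₂ l +
    wt cY₃ l + wt cX l + wt cZ l := by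
  induction l with
  | nil => rfl
  | cons g l ih =>
    simp only [List.length_cons, wt_cons, ih]
    cases g <;> simp only [cX₁, cX₂, cY₁, cY₂, cY₃, cX, cZ] <;> omega

lemma wt_eq (n : ℕ) (l : List (Gen V)) : wt (deg n) l = wt cX₁ l * (30 * n + 18) +
    wt cX₂ l * (36 * n + 22) + wt cY₁ l * (126 * n + 75) + wt cY₂ l * (132 * n + 79) +
    wt cY₃ l * (138 * n + 83) + wt cX l * (180 * n ^ 2 + 218 * n + 66) +
    wt cZ l * (540 * n ^ 2 + 654 * n + 197) := by
  induction l with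
  | nil => simp [wt]
  | cons g l ih =>
    simp only [wt_cons, ih]
    cases g <;> simp only [cX₁, cX₂, cY₁, cY₂, cY₃, cX, cZ, deg] <;> ring

lemma le_deg (n : ℕ) (g : Gen V) : 30 * n + 18 ≤ deg n g := by
  cases g <;> simp only [deg] <;> nlinarith [Nat.zero_le n]

lemma le_wt (n : ℕ) {l : List (Gen V)} (h : l ≠ []) : 30 * n + 18 ≤ wt (deg n) l := by
  cases l with
  | nil => exact absurd rfl h
  | cons g l => rw [wt_cons]; exact le_add_right (le_deg n g)

/-- Every generator has degree at least 30n+18, so next to a factor of degree above m - (30n+18)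
nothing else fits. -/
lemma eq_singleton {n m : ℕ} {w : Gen V → ℕ} {l : List (Gen V)} (hl : wt (deg n) l = m)
    (h : wt w l ≠ 0) (hm : ∀ g : Gen V, w g ≠ 0 → m < deg n g + (30 * n + 18)) :
    ∃ g, w g ≠ 0 ∧ deg n g = m ∧ l = [g] := by
  obtain ⟨g, l', hg, hp⟩ := exists_perm_cons h
  rw [wt_perm _ hp, wt_cons] at hl
  have h0 : l' = [] := by
    by_contra h0
    have := le_wt n h0
    have := hm g hg
    omega
  subst h0
  exact ⟨g, hg, by simpa [wt] using hl, List.perm_singleton.1 hp⟩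

lemma gr_eq_bot {n m : ℕ} (h0 : 0 < m) (hm : m < 30 * n + 18) :
    FreeCGA.gr (deg (V := V) n) m = ⊥ := by
  rw [eq_bot_iff]
  refine gr_le fun l hl => ?_
  have : l ≠ [] := by rintro rfl; simp [wt] at hl; omega
  have := le_wt n this
  omega

lemma gr_zero_le (n : ℕ) : FreeCGA.gr (deg (V := V) n) 0 ≤ ℚ ∙ 1 := by
  refine gr_le fun l hl => ?_
  have : l = [] := by
    by_contra h
    have := le_wt n h
    omega
  subst this
  exact Submodule.subset_span (by simp [mon])

lemma gr_x₁_le (n : ℕ) : FreeCGA.gr (deg (V := V) n) (deg n (x₁ : Gen V)) ≤ ℚ ∙ el n x₁ := by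
  refine gr_le fun l hl => ?_
  simp only [deg] at hl
  obtain ⟨g, -, hg, rfl⟩ := eq_singleton (w := fun _ => 1) hl
    (by rintro h; cases l <;> simp_all [wt]) (fun g _ => by have := le_deg n g; omega)
  have : g = x₁ := by
    cases g <;> simp only [deg] at hg <;> first | rfl | (exfalso; nlinarith [Nat.zero_le n])
  subst this
  exact Submodule.subset_span (by simp [mon_singleton])

lemma gr_x₂_le (n : ℕ) : FreeCGA.gr (deg (V := V) n) (deg n (x₂ : Gen V)) ≤ ℚ ∙ el n x₂ := by
  refine gr_le fun l hl => ?_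
  simp only [deg] at hl
  obtain ⟨g, -, hg, rfl⟩ := eq_singleton (w := fun _ => 1) hl
    (by rintro h; cases l <;> simp_all [wt]) (fun g _ => by have := le_deg n g; omega)
  have : g = x₂ := by
    cases g <;> simp only [deg] at hg <;> first | rfl | (exfalso; nlinarith [Nat.zero_le n])
  subst this
  exact Submodule.subset_span (by simp [mon_singleton])

/-- The indicator function of the odd generators. -/
def cOdd : Gen V → ℕ | y₁ => 1 | y₂ => 1 | y₃ => 1 | z => 1 | zv _ => 1 | _ => 0

lemma wt_cOdd (l : List (Gen V)) :
    wt cOdd l = wt cY₁ l + wt cY₂ l + wt cY₃ l + wt cZ l := by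
  induction l with
  | nil => rfl
  | cons g l ih =>
    simp only [wt_cons, ih]
    cases g <;> simp only [cOdd, cY₁, cY₂, cY₃, cZ] <;> omega

lemma wt_parity (n : ℕ) (l : List (Gen V)) : (wt (deg n) l + wt cOdd l) % 2 = 0 := by
  induction l with
  | nil => rfl
  | cons g l ih =>
    simp only [wt_cons]
    have : (deg n g + cOdd g) % 2 = 0 := by
      cases g <;> simp only [deg, cOdd] <;> ring_nf <;> omega
    omega

/-- A monomial of odd degree contains an odd generator. The smallest one, of degree 126n+75,
together with any other factor already exceeds |y₃|. -/
lemma gr_y_le {n : ℕ} {y : Gen V} (hy : y = y₁ ∨ y = y₂ ∨ y = y₃) :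
    FreeCGA.gr (deg (V := V) n) (deg n y) ≤ ℚ ∙ el n y := by
  refine gr_le fun l hl => ?_
  have hpar := wt_parity n l
  have hn := Nat.zero_le n
  obtain ⟨g, hg', hg, rfl⟩ := eq_singleton (w := cOdd) hl
    (by rw [hl] at hpar; rcases hy with rfl | rfl | rfl <;> simp only [deg] at hpar <;> omega)
    (fun g hg => by
      rcases hy with rfl | rfl | rfl <;> cases g <;> simp only [cOdd, deg] at hg ⊢ <;> omega)
  have : g = y := by
    rcases hy with rfl | rfl | rfl <;> cases g <;> simp only [cOdd, deg] at hg hg' <;>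
      first | rfl | omega
  subst this
  exact Submodule.subset_span (by simp [mon_singleton])

lemma gr_y_pred_eq_bot {n m : ℕ} (hn : 1 ≤ n) {y : Gen V} (hy : y = y₁ ∨ y = y₂ ∨ y = y₃)
    (hm : m + 1 = deg n y) : FreeCGA.gr (deg (V := V) n) m = ⊥ := by
  rw [eq_bot_iff]
  refine gr_le fun l hl => ?_
  exfalso
  have hpar := wt_parity n l
  have hw := wt_eq n l
  rw [wt_cOdd] at hpar
  have hlt : m < 138 * n + 83 := by
    rcases hy with rfl | rfl | rfl <;> simp only [deg] at hm <;> omega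
  have hpar' : m % 2 = 0 := by
    rcases hy with rfl | rfl | rfl <;> simp only [deg] at hm <;> omega
  generalize wt cX₁ l = i at *
  generalize wt cX₂ l = j at *
  generalize wt cY₁ l = e₁ at *
  generalize wt cY₂ l = e₂ at *
  generalize wt cY₃ l = e₃ at *
  generalize wt cX l = k at *
  generalize wt cZ l = s at *
  rw [hl] at hw
  have hs : s = 0 := by
    by_contra h
    nlinarith [Nat.pos_of_ne_zero h, Nat.mul_le_mul_right (540 * n ^ 2 + 654 * n + 197)
      (Nat.pos_of_ne_zero h)]
  have hk : k = 0 := by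
    by_contra h
    have : n ≤ n ^ 2 := Nat.le_self_pow two_ne_zero n
    nlinarith [Nat.mul_le_mul_right (180 * n ^ 2 + 218 * n + 66) (Nat.pos_of_ne_zero h)]
  have he : e₁ + e₂ + e₃ < 2 := by
    by_contra! h
    nlinarith [Nat.mul_le_mul_right (126 * n + 75) h]
  have hi : i ≤ 4 := by
    by_contra! h
    nlinarith [Nat.mul_le_mul_right (30 * n + 18) h]
  have hj : j ≤ 3 := by
    by_contra! h
    nlinarith [Nat.mul_le_mul_right (36 * n + 22) h]
  have he₁ : e₁ = 0 := by omega
  have he₂ : e₂ = 0 := by omega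
  have he₃ : e₃ = 0 := by omega
  subst hs hk he₁ he₂ he₃
  -- Only i copies of x₁ and j copies of x₂ remain; each of the finitely many pairs gives a linear
  -- equation in n with no solution.
  rcases hy with rfl | rfl | rfl <;> simp only [deg] at hm <;> interval_cases i <;>
    interval_cases j <;> omega

/-- The arithmetic of the degrees `|x₁| = 6N`, `|x₂| = 2K`, `|x_v| = 2KN`, `|z| = 6KN - 1`, where
`5K = 18N + 1`. -/
lemma arith {N K i j q Q r : ℤ} (hN : 0 < N) (h : 5 * K = 18 * N + 1) (hi : 0 < i + 6 * r)
    (e : 3 * N * i + K * j + K * N * Q = K * N * q + r) : 3 * N + j - 5 * r ≤ N * (q - Q) := by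
  -- Writing r as r(5K - 18N) makes K divide 3N(i + 6r), hence i + 6r. Being positive, i + 6r is Ks
  -- with s ≥ 1, and cancelling K leaves 3Ns = N(q - Q) - j + 5r.
  have hc : IsCoprime K (3 * N) := ⟨5, -6, by linarith⟩
  have he : (3 * N) * (i + 6 * r) = K * (N * (q - Q) - j + 5 * r) := by
    linear_combination e - r * h
  obtain ⟨s, hs⟩ := hc.dvd_of_dvd_mul_left (Dvd.intro _ he.symm)
  have hK : 0 < K := by linarith
  rw [hs] at he hi
  have hs0 : 0 < s := pos_of_mul_pos_right hi hK.le
  have he' : 3 * N * s = N * (q - Q) - j + 5 * r := by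
    apply mul_left_cancel₀ hK.ne'
    linear_combination he
  nlinarith

/-- A monomial vanishes, or each of `y₁`, `y₂`, `y₃` occurs at most once. -/
lemma mon_eq_zero_or (n : ℕ) (l : List (Gen V)) : mon (deg n) l = 0 ∨
    (wt cY₁ l ≤ 1 ∧ wt cY₂ l ≤ 1 ∧ wt cY₃ l ≤ 1) := by
  by_contra! h
  obtain ⟨h0, h⟩ := h
  have h₁ : wt cY₁ l ≤ 1 := by
    by_contra! h2
    exact h0 (mon_eq_zero (w := cY₁) (i := y₁) ⟨63 * n + 37, by simp only [deg]; ring⟩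
      (by intro j; cases j <;> simp [cY₁]) (by simp [cY₁]) h2)
  have h₂ : wt cY₂ l ≤ 1 := by
    by_contra! h2
    exact h0 (mon_eq_zero (w := cY₂) (i := y₂) ⟨66 * n + 39, by simp only [deg]; ring⟩
      (by intro j; cases j <;> simp [cY₂]) (by simp [cY₂]) h2)
  exact h0 (mon_eq_zero (w := cY₃) (i := y₃) ⟨69 * n + 41, by simp only [deg]; ring⟩
      (by intro j; cases j <;> simp [cY₃]) (by simp [cY₃]) (h h₁ h₂))

/-- An odd generator has degree one less than its differential. After adding the number of odd
factors, each y₁, y₂, y₃ counts as x₁³x₂, x₁²x₂², x₁x₂³ and each z, z_v as x_v³, which is the shape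
`arith` needs. -/
lemma wt_int (n : ℕ) (l : List (Gen V)) :
    (wt (deg n) l : ℤ) + (wt cY₁ l + wt cY₂ l + wt cY₃ l + wt cZ l) =
      2 * (3 * (5 * n + 3) * (wt cX₁ l + 3 * wt cY₁ l + 2 * wt cY₂ l + wt cY₃ l) +
        (18 * n + 11) * (wt cX₂ l + wt cY₁ l + 2 * wt cY₂ l + 3 * wt cY₃ l) +
        (18 * n + 11) * (5 * n + 3) * (wt cX l + 3 * wt cZ l)) := by
  rw [wt_eq]
  push_cast
  ring

end Gen

/-! ### The degrees of x_v and z, and the degrees just below -/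

namespace Gen

open FreeCGA

variable {V : Type u}

lemma eq_zero_of_wt {w : Gen V → ℕ} {l : List (Gen V)} (h : wt w l = 0) {g : Gen V} (hg : g ∈ l) :
    w g = 0 :=
  List.sum_eq_zero_iff.1 h _ (List.mem_map_of_mem hg)

lemma wt_cZ_eq_zero {n : ℕ} {l : List (Gen V)}
    (h : wt (deg n) l < 540 * n ^ 2 + 654 * n + 197) : wt cZ l = 0 := by
  by_contra h0
  have hw := wt_eq n l
  have := Nat.mul_le_mul_right (540 * n ^ 2 + 654 * n + 197) (Nat.pos_of_ne_zero h0)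
  omega

/-- A monomial containing some x_w is that generator alone. Otherwise any x₁ or y factor would, by
`arith`, make the degree too large, so only a power of x₂ is left. -/
lemma gr_x_le (n : ℕ) (v : V) : FreeCGA.gr (deg (V := V) n) (deg n (x v)) ≤
    Submodule.span ℚ (insert (el n x₂ ^ (5 * n + 3)) (Set.range fun w : V => el n (x w))) := by
  refine gr_le fun l hl => ?_
  rcases mon_eq_zero_or n l with h0 | ⟨h₁, h₂, h₃⟩
  · rw [h0]; exact zero_mem _
  have hs := wt_cZ_eq_zero (n := n) (l := l) (by rw [hl]; simp only [deg]; nlinarith [Nat.zero_le n])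
  have hw := wt_int n l
  have hlen := length_eq l
  have hX : wt cX l ≠ 0 → mon (deg n) l ∈ Submodule.span ℚ
      (insert (el n x₂ ^ (5 * n + 3)) (Set.range fun w : V => el n (x w))) := by
    intro hX
    obtain ⟨g, hg, -, rfl⟩ := eq_singleton (w := cX) hl hX (by
      intro g; cases g <;> simp only [cX, deg] <;> omega)
    cases g <;> simp only [cX, ne_eq, not_true_eq_false] at hg
    rw [mon_singleton]
    exact Submodule.subset_span (Or.inr ⟨_, rfl⟩)
  by_cases hX0 : wt cX l = 0
  swap
  · exact hX hX0
  rw [hl, hs, hX0] at hw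
  simp only [deg] at hw
  have key : wt cX₁ l = 0 ∧ wt cY₁ l = 0 ∧ wt cY₂ l = 0 ∧ wt cY₃ l = 0 ∧
      wt cX₂ l = 5 * n + 3 := by
    have hn : (0 : ℤ) ≤ n := by positivity
    clear hX hlen hl
    generalize wt cX₁ l = i at *
    generalize wt cX₂ l = j at *
    generalize wt cY₁ l = e₁ at *
    generalize wt cY₂ l = e₂ at *
    generalize wt cY₃ l = e₃ at *
    -- Here r is half the number of odd factors, the error made when y's are replaced by their
    -- differentials.
    have hlow (r : ℤ) (hr : 0 < (i + 3 * e₁ + 2 * e₂ + e₃ : ℤ) + 6 * r)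
        (hr' : (e₁ + e₂ + e₃ : ℤ) = 2 * r) : (3 * (5 * n + 3) : ℤ) +
          (j + e₁ + 2 * e₂ + 3 * e₃) - 5 * r ≤ (5 * n + 3) * (1 - 0) :=
      arith (N := 5 * n + 3) (K := 18 * n + 11) (by linarith) (by ring) hr (by
        push_cast at hw ⊢; linarith)
    -- The degree is even and each y occurs at most once.
    have hpar : (e₁ + e₂ + e₃ : ℤ) = 0 ∨ (e₁ + e₂ + e₃ : ℤ) = 2 := by
      push_cast at hw
      ring_nf at hw
      omega
    rcases hpar with hE | hE
    · have h1 : e₁ = 0 := by omega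
      have h2 : e₂ = 0 := by omega
      have h3 : e₃ = 0 := by omega
      have hi : i = 0 := by
        by_contra hi
        have := hlow 0 (by omega) (by omega)
        omega
      subst h1 h2 h3 hi
      refine ⟨rfl, rfl, rfl, rfl, ?_⟩
      have : (18 * n + 11 : ℤ) * j = (18 * n + 11) * (5 * n + 3) := by
        push_cast at hw; linarith
      exact_mod_cast mul_left_cancel₀ (by omega) this
    · have := hlow 1 (by omega) (by omega)
      omega
  obtain ⟨k1, k2, k3, k4, k5⟩ := key
  have hl' : l = List.replicate (5 * n + 3) x₂ := by
    refine List.eq_replicate_of_mem (a := x₂) (fun g hg => ?_) |>.trans (by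
      congr 1; omega)
    have hz {w : Gen V → ℕ} (h : wt w l = 0) : w g = 0 := eq_zero_of_wt h hg
    have z1 := hz k1
    have z2 := hz k2
    have z3 := hz k3
    have z4 := hz k4
    have z5 := hz hX0
    have z6 := hz hs
    cases g <;> simp only [cX₁, cY₁, cY₂, cY₃, cX, cZ, one_ne_zero] at *
  rw [hl', mon, List.map_replicate, List.prod_replicate]
  exact Submodule.subset_span (Or.inl rfl)

lemma gr_x_pred_eq_bot {n m : ℕ} {v : V} (hm : m + 1 = deg n (x v)) :
    FreeCGA.gr (deg (V := V) n) m = ⊥ := by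
  rw [eq_bot_iff]
  refine gr_le fun l hl => ?_
  rcases mon_eq_zero_or n l with h0 | ⟨h₁, h₂, h₃⟩
  · rw [h0]; exact zero_mem _
  exfalso
  simp only [deg] at hm
  have hs := wt_cZ_eq_zero (n := n) (l := l) (by rw [hl]; nlinarith [Nat.zero_le n])
  have hw := wt_int n l
  rw [hl, hs] at hw
  replace hm : (m : ℤ) = 180 * n ^ 2 + 218 * n + 65 := by
    have := congrArg (Nat.cast : ℕ → ℤ) hm
    push_cast at this
    linarith
  rw [hm] at hw
  have hn : (0 : ℤ) ≤ n := by positivity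
  clear hl
  generalize wt cX₁ l = i at *
  generalize wt cX₂ l = j at *
  generalize wt cY₁ l = e₁ at *
  generalize wt cY₂ l = e₂ at *
  generalize wt cY₃ l = e₃ at *
  generalize wt cX l = k at *
  -- The degree is now 2KN - 1, so one odd factor is absorbed by the -1 and r is half of the
  -- remaining ones.
  have hlow (r : ℤ) (hr : 0 < (i + 3 * e₁ + 2 * e₂ + e₃ : ℤ) + 6 * r)
      (hr' : (e₁ + e₂ + e₃ : ℤ) = 2 * r + 1) : (3 * (5 * n + 3) : ℤ) +
        (j + e₁ + 2 * e₂ + 3 * e₃) - 5 * r ≤ (5 * n + 3) * (1 - k) :=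
    arith (N := 5 * n + 3) (K := 18 * n + 11) (by linarith) (by ring) hr (by
      push_cast at hw ⊢; linarith)
  have hk : (5 * n + 3 : ℤ) * (1 - k) ≤ 5 * n + 3 := by nlinarith
  have hpar : (e₁ + e₂ + e₃ : ℤ) = 1 ∨ (e₁ + e₂ + e₃ : ℤ) = 3 := by
    push_cast at hw
    ring_nf at hw
    omega
  rcases hpar with hE | hE
  · have := hlow 0 (by omega) (by omega)
    omega
  · have := hlow 1 (by omega) (by omega)
    omega

lemma gr_z_le (n : ℕ) : FreeCGA.gr (deg (V := V) n) (deg n (z : Gen V)) ≤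
    Submodule.span ℚ (insert (el n z) (Set.range fun w : V => el n (zv w))) := by
  refine gr_le fun l hl => ?_
  rcases mon_eq_zero_or n l with h0 | ⟨h₁, h₂, h₃⟩
  · rw [h0]; exact zero_mem _
  by_cases hs : wt cZ l = 0
  swap
  · obtain ⟨g, hg, -, rfl⟩ := eq_singleton (w := cZ) hl hs (by
      intro g; cases g <;> simp only [cZ, deg] <;> omega)
    rw [mon_singleton]
    cases g <;> simp only [cZ, ne_eq, not_true_eq_false] at hg
    · exact Submodule.subset_span (Or.inl rfl)
    · exact Submodule.subset_span (Or.inr ⟨_, rfl⟩)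
  exfalso
  have hw := wt_int n l
  rw [hl, hs] at hw
  simp only [deg] at hw
  have hn : (0 : ℤ) ≤ n := by positivity
  clear hl
  generalize wt cX₁ l = i at *
  generalize wt cX₂ l = j at *
  generalize wt cY₁ l = e₁ at *
  generalize wt cY₂ l = e₂ at *
  generalize wt cY₃ l = e₃ at *
  generalize wt cX l = k at *
  have hlow (r : ℤ) (hr : 0 < (i + 3 * e₁ + 2 * e₂ + e₃ : ℤ) + 6 * r)
      (hr' : (e₁ + e₂ + e₃ : ℤ) = 2 * r + 1) : (3 * (5 * n + 3) : ℤ) +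
        (j + e₁ + 2 * e₂ + 3 * e₃) - 5 * r ≤ (5 * n + 3) * (3 - k) :=
    arith (N := 5 * n + 3) (K := 18 * n + 11) (by linarith) (by ring) hr (by
      push_cast at hw ⊢; linarith)
  have hk : (5 * n + 3 : ℤ) * (3 - k) ≤ 3 * (5 * n + 3) := by nlinarith
  have hpar : (e₁ + e₂ + e₃ : ℤ) = 1 ∨ (e₁ + e₂ + e₃ : ℤ) = 3 := by
    push_cast at hw
    ring_nf at hw
    omega
  rcases hpar with hE | hE
  · have := hlow 0 (by omega) (by omega)
    omega
  -- All three y's occur; they contribute 1 + 2 + 3 = 6 to the exponent of x₂, just above the slack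
  -- 5r = 5.
  · have := hlow 1 (by omega) (by omega)
    omega

section Differential

variable [Fintype V] (G : SimpleGraph V) [DecidableRel G.Adj]

lemma der_mon_eq_zero (n : ℕ) {l : List (Gen V)} (h : wt cOdd l = 0) :
    FreeCGA.der _ (dGen_mem n G) (mon (deg n) l) = 0 := by
  induction l with
  | nil => simp [mon, FreeCGA.der]
  | cons g l ih =>
    rw [wt_cons] at h
    rw [mon_cons]
    refine der_zero_mul n G ?_ (ih (by omega))
    rw [FreeCGA.der_ι]
    cases g <;> simp only [cOdd] at h <;> first | rfl | omega

/-- This component is not zero: it contains x₁⁶x₂^(15n+4). But a nonzero monomial here has no odd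
factor, since two of them would violate `arith`, and all even generators are cocycles. -/
lemma der_eq_zero_of_mem {n m : ℕ} (hm : m + 1 = deg n (z : Gen V))
    {a : FreeCGA (deg (V := V) n)} (ha : a ∈ FreeCGA.gr (deg n) m) :
    FreeCGA.der _ (dGen_mem n G) a = 0 := by
  refine (gr_le (S := LinearMap.ker (FreeCGA.der _ (dGen_mem n G))) fun l hl => ?_) ha
  rcases mon_eq_zero_or n l with h0 | ⟨h₁, h₂, h₃⟩
  · rw [h0]; exact zero_mem _
  refine der_mon_eq_zero G n ?_
  simp only [deg] at hm
  have hs := wt_cZ_eq_zero (n := n) (l := l) (by rw [hl]; omega)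
  have hw := wt_int n l
  rw [hl, hs] at hw
  rw [wt_cOdd, hs]
  replace hm : (m : ℤ) = 540 * n ^ 2 + 654 * n + 196 := by
    have := congrArg (Nat.cast : ℕ → ℤ) hm
    push_cast at this
    linarith
  rw [hm] at hw
  have hn : (0 : ℤ) ≤ n := by positivity
  clear hl
  generalize wt cX₁ l = i at *
  generalize wt cX₂ l = j at *
  generalize wt cY₁ l = e₁ at *
  generalize wt cY₂ l = e₂ at *
  generalize wt cY₃ l = e₃ at *
  generalize wt cX l = k at *
  by_contra h0
  have hpar : (e₁ + e₂ + e₃ : ℤ) = 2 := by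
    push_cast at hw
    ring_nf at hw
    omega
  have hlow : (3 * (5 * n + 3) : ℤ) +
        (j + e₁ + 2 * e₂ + 3 * e₃) - 5 * 0 ≤ (5 * n + 3) * (3 - k) :=
    arith (N := 5 * n + 3) (K := 18 * n + 11) (i := i + 3 * e₁ + 2 * e₂ + e₃)
      (by linarith) (by ring) (by omega) (by push_cast at hw ⊢; linarith)
  have hk : (5 * n + 3 : ℤ) * (3 - k) ≤ 3 * (5 * n + 3) := by nlinarith
  omega

end Differential

end Gen

/-! ### Homotopies forced to be constant -/

namespace CDGA

/-- The constant paths. -/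
def PathAlg.const (A : CDGA.{u}) : A →ₐ[ℚ] PathAlg A :=
  AlgHom.ofLinearMap
    { toFun := fun a => PathAlg.mk (Polynomial.C a) 0
      map_add' := fun a b => by apply PathAlg.ext <;> simp
      map_smul' := fun c a => by apply PathAlg.ext <;> simp [Polynomial.smul_C] }
    (by apply PathAlg.ext <;> simp)
    (fun a b => by apply PathAlg.ext <;> simp)

lemma eq_C_of_derivative_eq_zero {A : Type u} [Ring A] [Algebra ℚ A] {p : A[X]}
    (h : Polynomial.derivative p = 0) : p = Polynomial.C (p.eval 0) := by
  ext k
  cases k with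
  | zero => simp [Polynomial.coeff_zero_eq_eval_zero]
  | succ k =>
    have hk := congrArg (fun q => Polynomial.coeff q k) h
    simp only [Polynomial.coeff_derivative, Polynomial.coeff_zero] at hk
    rw [← Nat.cast_add_one, ← nsmul_eq_mul', ← Nat.cast_smul_eq_nsmul ℚ] at hk
    rw [(smul_eq_zero.1 hk).resolve_left (by positivity)]
    simp

variable {A : CDGA.{u}} {B : CDGA.{v}}

/-- A homotopy is constant on `a` if it is so on `d a` and the differential vanishes in the
relevant degree. -/
lemma fst_homotopy (H : Hom A B.path) {m : ℕ} {a : A} (ha : a ∈ A.gr m)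
    (hda : (H.toAlgHom (A.d a) : PathAlg B).2 = 0)
    (hB : ∀ q ∈ PathAlg.shiftGr B m, B.d q = 0) :
    (H.toAlgHom a : PathAlg B).1 = Polynomial.C (ev₀ (H.toAlgHom a)) := by
  -- Writing H a = p + q dt, the dt-part of d(H a) = H(d a) reads ± p' + dq = 0. Once dq = 0, p has
  -- zero derivative, hence is constant in characteristic zero.
  have hd : PathAlg.sgn B (Polynomial.derivative (H.toAlgHom a : PathAlg B).1) +
      PathAlg.D B (H.toAlgHom a : PathAlg B).2 = 0 := by
    rw [← hda]
    exact congrArg Prod.snd (H.map_d a).symm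
  have hD : PathAlg.D B (H.toAlgHom a : PathAlg B).2 = 0 := by
    ext k
    rw [coeff_coeffMap]
    exact hB _ (H.map_gr ha k).2
  rw [hD, add_zero] at hd
  apply eq_C_of_derivative_eq_zero
  ext k
  have hk := congrArg (fun q => B.sign (Polynomial.coeff q k)) hd
  simpa only [PathAlg.coeff_sgn, B.sign_sign, Polynomial.coeff_zero, map_zero] using hk

end CDGA

/-! ### Minimality, connectivity, and homotopy as equality -/

namespace Gen

open FreeCGA CDGA

lemma eq_zero_of_mem {M : Type u} [AddCommGroup M] [Module ℚ M] {S : Submodule ℚ M} (h : S = ⊥)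
    {a : M} (ha : a ∈ S) : a = 0 :=
  (Submodule.mem_bot ℚ).1 (h ▸ ha)

variable {V : Type u} (n : ℕ)

/-- The stage of a generator in the nilpotence filtration. -/
def stage : Gen V → ℕ
  | x₁ => 0 | x₂ => 0 | x _ => 0 | y₁ => 1 | y₂ => 1 | y₃ => 1 | z => 2 | zv _ => 2

/-- The ideal `Λ^{≥ 2} W`, as a subspace. -/
abbrev decomposables : Submodule ℚ (FreeCGA (deg (V := V) n)) :=
  Submodule.span ℚ {a | ∃ l : List (Gen V), 2 ≤ l.length ∧ a = (l.map (el n)).prod}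

lemma mem_decomposables_of_pow {g : Gen V} {k : ℕ} (hk : 2 ≤ k) :
    el n g ^ k ∈ decomposables (V := V) n :=
  Submodule.subset_span ⟨List.replicate k g, by simpa using hk, by simp⟩

lemma mul_mem_decomposables_right {a : FreeCGA (deg (V := V) n)} (ha : a ∈ decomposables n)
    (g : Gen V) : a * el n g ∈ decomposables (V := V) n := by
  induction ha using Submodule.span_induction with
  | zero => rw [zero_mul]; exact zero_mem _
  | add x y _ _ hx hy => rw [add_mul]; exact add_mem hx hy
  | smul c x _ hx => rw [smul_mul_assoc]; exact Submodule.smul_mem _ _ hx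
  | mem x hx =>
    obtain ⟨l, hl, rfl⟩ := hx
    exact Submodule.subset_span ⟨l ++ [g], by simp; omega, by simp⟩

lemma mul_mem_decomposables_left {a : FreeCGA (deg (V := V) n)} (ha : a ∈ decomposables n)
    (g : Gen V) : el n g * a ∈ decomposables (V := V) n := by
  induction ha using Submodule.span_induction with
  | zero => rw [mul_zero]; exact zero_mem _
  | add x y _ _ hx hy => rw [mul_add]; exact add_mem hx hy
  | smul c x _ hx => rw [mul_smul_comm]; exact Submodule.smul_mem _ _ hx
  | mem x hx =>
    obtain ⟨l, hl, rfl⟩ := hx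
    exact Submodule.subset_span ⟨g :: l, by simp; omega, by simp⟩

lemma el_mul_el_mem (g h : Gen V) : el n g * el n h ∈ decomposables (V := V) n :=
  Submodule.subset_span ⟨[g, h], by simp, by simp⟩

lemma pow_mul_mem_decomposables {a : FreeCGA (deg (V := V) n)} (ha : a ∈ decomposables n)
    (g : Gen V) (k : ℕ) : el n g ^ k * a ∈ decomposables (V := V) n := by
  induction k with
  | zero => simpa using ha
  | succ k ih => rw [pow_succ', mul_assoc]; exact mul_mem_decomposables_left n ih g

lemma mul_pow_mem_decomposables {a : FreeCGA (deg (V := V) n)} (ha : a ∈ decomposables n)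
    (g : Gen V) (k : ℕ) : a * el n g ^ k ∈ decomposables (V := V) n := by
  induction k with
  | zero => simpa using ha
  | succ k ih => rw [pow_succ, ← mul_assoc]; exact mul_mem_decomposables_right n ih g

/-- The point of `ΛW` at which `x₁`, `x₂`, `x_w` take the values `s`, `t`, `p w` and the odd
generators vanish. -/
def evenEval (s t : ℚ) (p : V → ℚ) : FreeCGA (deg (V := V) n) →ₐ[ℚ] ℚ :=
  FreeCGA.lift (fun g => match g with
    | x₁ => s | x₂ => t | x w => p w | y₁ => 0 | y₂ => 0 | y₃ => 0 | z => 0 | zv _ => 0) (by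
    have e₁ : Even (deg n (x₁ : Gen V)) := ⟨15 * n + 9, by simp only [deg]; ring⟩
    have e₂ : Even (deg n (x₂ : Gen V)) := ⟨18 * n + 11, by simp only [deg]; ring⟩
    have e₃ (v : V) : Even (deg n (x v)) := ⟨90 * n ^ 2 + 109 * n + 33, by simp only [deg]; ring⟩
    intro g h
    cases g <;> cases h <;> simp [(e₁.mul_right _).neg_one_pow, (e₁.mul_left _).neg_one_pow,
      (e₂.mul_right _).neg_one_pow, (e₂.mul_left _).neg_one_pow, ((e₃ _).mul_right _).neg_one_pow,
      mul_comm])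

/-- The dt-part of a homotopy on g has coefficients in this component, so on generators of stage 0
and 1 it vanishes. -/
lemma gr_pred_eq_bot (hn : 1 ≤ n) {g : Gen V} (hg : stage g < 2) {m : ℕ} (hm : m + 1 = deg n g) :
    FreeCGA.gr (deg (V := V) n) m = ⊥ := by
  cases g with
  | x₁ => simp only [deg] at hm; exact gr_eq_bot (by omega) (by omega)
  | x₂ =>
    simp only [deg] at hm
    rw [eq_bot_iff]
    refine gr_le fun l hl => ?_
    obtain ⟨g, -, hg, rfl⟩ := eq_singleton (w := fun _ => 1) hl
      (by rintro h; cases l <;> simp_all [wt]) (fun g _ => by have := le_deg n g; omega)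
    exfalso
    cases g <;> simp only [deg] at hg <;> nlinarith
  | x v => exact gr_x_pred_eq_bot hm
  | y₁ => exact gr_y_pred_eq_bot hn (by simp) hm
  | y₂ => exact gr_y_pred_eq_bot hn (by simp) hm
  | y₃ => exact gr_y_pred_eq_bot hn (by simp) hm
  | z => simp [stage] at hg
  | zv v => simp [stage] at hg

instance [Finite V] : Finite (Gen V) :=
  Finite.of_injective
    (fun g : Gen V => (match g with
      | x₁ => (0, none) | x₂ => (1, none) | y₁ => (2, none) | y₂ => (3, none) | y₃ => (4, none)
      | z => (5, none) | x v => (6, some v) | zv v => (7, some v) : Fin 8 × Option V))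
    (by intro g h; cases g <;> cases h <;> simp)

variable [Fintype V] (G : SimpleGraph V) [DecidableRel G.Adj]

lemma dGen_mem_adjoin (g : Gen V) :
    dGen n G g ∈ Algebra.adjoin ℚ (el n '' {h | stage h < stage g}) := by
  have hs (h : Gen V) (hh : stage h < stage g) :
      el n h ∈ Algebra.adjoin ℚ (el n '' {h | stage h < stage g}) :=
    Algebra.subset_adjoin ⟨h, hh, rfl⟩
  cases g with
  | x₁ => exact zero_mem _
  | x₂ => exact zero_mem _
  | x v => exact zero_mem _
  | y₁ => exact mul_mem (_root_.pow_mem (hs x₁ (by simp [stage])) _) (hs x₂ (by simp [stage]))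
  | y₂ =>
    exact mul_mem (_root_.pow_mem (hs x₁ (by simp [stage])) _)
      (_root_.pow_mem (hs x₂ (by simp [stage])) _)
  | y₃ => exact mul_mem (hs x₁ (by simp [stage])) (_root_.pow_mem (hs x₂ (by simp [stage])) _)
  | z =>
    have h1 := hs x₁ (by simp [stage])
    have h2 := hs x₂ (by simp [stage])
    have k1 := hs y₁ (by simp [stage])
    have k2 := hs y₂ (by simp [stage])
    have k3 := hs y₃ (by simp [stage])
    exact add_mem (add_mem (mul_mem (_root_.pow_mem h1 _) (add_mem (sub_mem
      (mul_mem (mul_mem (_root_.pow_mem h1 _) k2) k3) (mul_mem (mul_mem (mul_mem h1 h2) k1) k3))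
      (mul_mem (mul_mem (_root_.pow_mem h2 _) k1) k2))) (_root_.pow_mem h1 _)) (_root_.pow_mem h2 _)
  | zv v =>
    exact add_mem (_root_.pow_mem (hs (x v) (by simp [stage])) _) (sum_mem fun w _ =>
      mul_mem (mul_mem (hs (x v) (by simp [stage])) (hs (x w) (by simp [stage])))
        (_root_.pow_mem (hs x₂ (by simp [stage])) _))

lemma dGen_mem_decomposables (g : Gen V) : dGen n G g ∈ decomposables (V := V) n := by
  have hp (g : Gen V) {k : ℕ} (hk : 2 ≤ k) := mem_decomposables_of_pow n (g := g) hk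
  have hr {a} (ha : a ∈ decomposables n) (g : Gen V) := mul_mem_decomposables_right n ha g
  cases g with
  | x₁ => exact zero_mem _
  | x₂ => exact zero_mem _
  | x v => exact zero_mem _
  | y₁ => exact hr (hp _ (by omega)) _
  | y₂ => exact mul_pow_mem_decomposables n (hp _ (by omega)) _ _
  | y₃ => exact mul_mem_decomposables_left n (hp _ (by omega)) _
  | z =>
    exact add_mem (add_mem (pow_mul_mem_decomposables n (add_mem (sub_mem
      (hr (hr (hp _ le_rfl) _) _) (hr (hr (el_mul_el_mem n _ _) _) _)) (hr (hr (hp _ le_rfl) _) _))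
      _ _) (hp _ (by omega))) (hp _ (by omega))
  | zv v =>
    exact add_mem (hp _ (by omega)) (sum_mem fun w _ =>
      mul_pow_mem_decomposables n (el_mul_el_mem n _ _) _ _)

theorem isMinimalSullivan : (graphAlgebra n G).IsMinimalSullivan := by
  refine ⟨Gen V, deg n, fun g => el n g, fun g => FreeCGA.ι_mem g, fun g => ?_, fun m =>
    Set.toFinite _, ?_, ⟨stage, fun g => ?_⟩, fun g => ?_⟩
  · have := le_deg n g
    omega
  · have : (graphAlgebra n G).ofGens (fun g => el n g) (fun g => FreeCGA.ι_mem g) =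
        AlgHom.id ℚ (FreeCGA (deg (V := V) n)) :=
      FreeCGA.algHom_ext fun g => FreeCGA.lift_ι _ _ g
    rw [this]
    exact Function.bijective_id
  · have := dGen_mem_adjoin n G g
    rw [← FreeCGA.der_ι (dGen n G) (dGen_mem n G) g] at this
    exact this
  · have := dGen_mem_decomposables n G g
    rw [← FreeCGA.der_ι (dGen n G) (dGen_mem n G) g] at this
    exact this

/-- The smallest generator has degree 30n+18, so the algebra itself, not only its cohomology, is
zero in the positive degrees below. -/
theorem isConnected : (graphAlgebra n G).IsConnected (30 * n + 17) := by
  refine ⟨fun h => ?_, fun a ha _ => ?_, fun i hi a ha _ => ⟨0, zero_mem _, ?_⟩⟩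
  · have : evenEval n 0 0 (0 : V → ℚ) 1 = evenEval n 0 0 (0 : V → ℚ) 0 := congrArg _ h
    simp at this
  · obtain ⟨c, hc⟩ := Submodule.mem_span_singleton.1 (gr_zero_le n ha)
    exact ⟨c, hc.symm⟩
  · have ha' : a ∈ FreeCGA.gr (deg (V := V) n) (i + 1) := ha
    rw [map_zero]
    exact (eq_zero_of_mem (gr_eq_bot (by omega) (by omega)) ha').symm

/-- Homotopic maps are equal, for reasons of degree. -/
theorem eq_of_homotopic (hn : 1 ≤ n) {f f' : CDGA.End (graphAlgebra n G)} (h : Homotopic f f') :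
    f = f' := by
  obtain ⟨H, hH⟩ := h
  let A := graphAlgebra n G
  let c : A →ₐ[ℚ] PathAlg A := (PathAlg.const A).comp f.toAlgHom
  let F : A →ₐ[ℚ] PathAlg A := H.toAlgHom
  let e : Gen V → A := el n
  have hmem (g : Gen V) : e g ∈ A.gr (deg n g) := FreeCGA.ι_mem g
  have hclosed (g : Gen V) (q : A) (hq : q ∈ PathAlg.shiftGr A (deg n g)) : A.d q = 0 := by
    obtain ⟨m, hm⟩ : ∃ m, m + 1 = deg n g := ⟨deg n g - 1, by have := le_deg n g; omega⟩
    rw [← hm] at hq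
    by_cases hs : stage g < 2
    · have h0 : q = (0 : A) := eq_zero_of_mem (gr_pred_eq_bot n hn hs hm) hq
      rw [h0, map_zero]
    · have hz : deg n g = deg n (z : Gen V) := by cases g <;> simp [stage] at hs <;> rfl
      exact der_eq_zero_of_mem G (hm.trans hz) hq
  have hfst (g : Gen V) (hg : F (A.d (e g)) = c (A.d (e g))) :
      (F (e g)).1 = Polynomial.C (f.toAlgHom (e g)) := by
    have := fst_homotopy H (hmem g) (congrArg Prod.snd hg) (hclosed g)
    rwa [(hH _).1] at this
  -- H and the constant homotopy at f agree on a subalgebra; if it contains the earlier stages, it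
  -- contains the differential of g.
  have hagree (k : ℕ) (hk : ∀ g : Gen V, stage g < k → F (e g) = c (e g)) (g : Gen V)
      (hg : stage g = k) : F (A.d (e g)) = c (A.d (e g)) := by
    have hg' := dGen_mem_adjoin n G g
    rw [← FreeCGA.der_ι (dGen n G) (dGen_mem n G) g] at hg'
    have hle : Algebra.adjoin ℚ (e '' {h | stage h < stage g}) ≤ AlgHom.equalizer F c :=
      Algebra.adjoin_le (by rintro _ ⟨h, hh, rfl⟩; exact hk h (hg ▸ hh))
    exact hle hg'
  have hfull (g : Gen V) (hs : stage g < 2) (hg : F (A.d (e g)) = c (A.d (e g))) :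
      F (e g) = c (e g) := by
    refine PathAlg.ext (hfst g hg) ?_
    ext k
    have hq := (H.map_gr (hmem g) k).2
    obtain ⟨m, hm⟩ : ∃ m, m + 1 = deg n g := ⟨deg n g - 1, by have := le_deg n g; omega⟩
    rw [← hm] at hq
    exact eq_zero_of_mem (gr_pred_eq_bot n hn hs hm) hq
  have h0 (g : Gen V) (hg : stage g = 0) : F (e g) = c (e g) :=
    hfull g (by omega) (hagree 0 (by simp) g hg)
  have h1 (g : Gen V) (hg : stage g = 1) : F (e g) = c (e g) :=
    hfull g (by omega) (hagree 1 (fun g hg => h0 g (by omega)) g hg)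
  have hle (g : Gen V) : stage g ≤ 2 := by cases g <;> simp [stage]
  -- On z and z_v a dt-part may survive, but their differentials involve only stages 0 and 1, so the
  -- part without dt is still constant.
  have hall (g : Gen V) : F (A.d (e g)) = c (A.d (e g)) := by
    have := hle g
    refine hagree (stage g) (fun h hh => ?_) g rfl
    rcases (show stage h = 0 ∨ stage h = 1 by omega) with h' | h'
    exacts [h0 h h', h1 h h']
  refine CDGA.Hom.ext (FreeCGA.algHom_ext fun g => ?_)
  have h2 : ev₁ (F (e g)) = f.toAlgHom (e g) := by
    rw [ev₁, hfst g (hall g), Polynomial.eval_C]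
  exact h2.symm.trans (hH (e g)).2

end Gen

/-! ### Rigidity of the cubic forms attached to a graph -/

/-- Compare coefficients of s²t, s³, t³, s² and st. The ten sample points match the ten monomials of
degree at most 3 in two variables and determine such a polynomial, so each coefficient is a linear
combination of the sampled values. -/
lemma coeffs_of_forall_eq {g a b c p q E F k : ℚ}
    (h : ∀ s t : ℚ, (g + a * s + b * t) ^ 3 + (g + a * s + b * t) * (c + p * s + q * t) =
      E * s ^ 3 + F * t ^ 3 + k * (s * t)) :
    a ^ 2 * b = 0 ∧ E = a ^ 3 ∧ F = b ^ 3 ∧ 3 * g * a ^ 2 + a * p = 0 ∧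
      6 * g * a * b + a * q + b * p = k := by
  have h00 := h 0 0
  have h10 := h 1 0
  have h20 := h (-1) 0
  have h30 := h 2 0
  have h01 := h 0 1
  have h02 := h 0 (-1)
  have h03 := h 0 2
  have h11 := h 1 1
  have h12 := h (-1) 1
  have h13 := h 1 (-1)
  ring_nf at h00 h10 h20 h30 h01 h02 h03 h11 h12 h13
  refine ⟨?_, ?_, ?_, ?_, ?_⟩ <;> ring_nf <;> linarith

section Rigidity

variable {V : Type u} [Fintype V]

lemma sum_single_add_single_mul [DecidableEq V] (w y : V) (s t : ℚ) (q : V → ℚ) :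
    ∑ i, (Pi.single w s + Pi.single y t : V → ℚ) i * q i = s * q w + t * q y := by
  simp [Pi.single_apply, add_mul, Finset.sum_add_distrib]

variable (G : SimpleGraph V) [DecidableRel G.Adj]

lemma sum_neighborFinset_single [DecidableEq V] (v w y : V) (s t : ℚ) :
    ∑ i ∈ G.neighborFinset v, (Pi.single w s + Pi.single y t : V → ℚ) i =
      s * (if G.Adj v w then 1 else 0) + t * (if G.Adj v y then 1 else 0) := by
  simp [Pi.single_apply, Finset.sum_add_distrib]

/-- The only injective linear substitutions compatible with the cubic forms
`x_v ^ 3 + ∑ x_v x_w` of a graph are those coming from its automorphisms. -/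
theorem exists_aut_of_cubic_identity [Nontrivial V] [DecidableEq V] (hG : G.Connected)
    (a e : V → V → ℚ) (γ : V → ℚ)
    (h : ∀ (v : V) (p : V → ℚ), (γ v + ∑ w, a v w * p w) ^ 3 +
      ∑ y ∈ G.neighborFinset v, (γ v + ∑ w, a v w * p w) * (γ y + ∑ w, a y w * p w) =
      ∑ w, e v w * (p w ^ 3 + ∑ y ∈ G.neighborFinset w, p w * p y))
    (hinj : ∀ c : V → ℚ, (∀ w, ∑ v, c v * a v w = 0) → c = 0) :
    ∃ σ : G ≃g G, ∀ v, γ v = 0 ∧ a v = Pi.single (σ v) 1 ∧ e v = Pi.single (σ v) 1 := by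
  -- Restrict to points p supported on the two vertices w and y, with values s and t.
  have key (v w y : V) (hwy : w ≠ y) := coeffs_of_forall_eq (g := γ v) (a := a v w) (b := a v y)
    (c := ∑ i ∈ G.neighborFinset v, γ i) (p := ∑ i ∈ G.neighborFinset v, a i w)
    (q := ∑ i ∈ G.neighborFinset v, a i y) (E := e v w) (F := e v y)
    (k := (e v w + e v y) * if G.Adj w y then 1 else 0) (by
      intro s t
      have hL (i : V) : γ i + ∑ j, a i j * (Pi.single w s + Pi.single y t : V → ℚ) j =
          γ i + a i w * s + a i y * t := by
        simp_rw [mul_comm (a i _)]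
        rw [sum_single_add_single_mul]
        ring
      have h0 := h v (Pi.single w s + Pi.single y t)
      simp_rw [hL, ← Finset.mul_sum, sum_neighborFinset_single] at h0
      -- Each cubic is divisible by its own variable; pulling it out collapses the sum to the two
      -- vertices of the support.
      have hR (q r : V → ℚ) : ∀ i, e v i * (r i ^ 3 + r i * q i) = r i * (e v i * (r i ^ 2 + q i)) :=
        fun i => by ring
      have hR' := hR (fun i => s * (if G.Adj i w then 1 else 0) + t * (if G.Adj i y then 1 else 0))
        (Pi.single w s + Pi.single y t)
      simp_rw [hR', sum_single_add_single_mul] at h0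
      rw [Finset.sum_add_distrib, Finset.sum_add_distrib, ← Finset.sum_mul, ← Finset.sum_mul] at h0
      rw [h0]
      simp only [Pi.add_apply, Pi.single_eq_same, Pi.single_eq_of_ne hwy,
        Pi.single_eq_of_ne hwy.symm, SimpleGraph.irrefl, if_false, G.adj_comm y w]
      ring)
  have hex (v : V) : ∃ w, a v w ≠ 0 := by
    by_contra! hv
    have := congrFun (hinj (Pi.single v 1) (fun w => by simp [Pi.single_apply, hv])) v
    simp at this
  choose σ hσ using hex
  -- The right-hand side has no s²t term, so a row cannot have two nonzero entries.
  have hoff (v w : V) (hw : w ≠ σ v) : a v w = 0 := by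
    have := (key v (σ v) w hw.symm).1
    exact (mul_eq_zero.1 this).resolve_left (pow_ne_zero 2 (hσ v))
  have hσi : Function.Injective σ := by
    intro v v' hv
    by_contra hne
    -- Two rows supported at the same vertex are proportional; this is their linear relation.
    have := congrFun (hinj (Pi.single v (a v' (σ v')) + Pi.single v' (- a v (σ v))) (fun w => by
      rw [sum_single_add_single_mul]
      by_cases hw : w = σ v
      · subst hw; rw [hv]; ring
      · rw [hoff v w hw, hoff v' w (hv ▸ hw)]; ring)) v
    simp [Pi.single_eq_of_ne hne, hσ] at this
  have hsum (v v' : V) : ∑ i ∈ G.neighborFinset v, a i (σ v') =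
      if G.Adj v v' then a v' (σ v') else 0 := by
    have : ∀ i, a i (σ v') = if i = v' then a v' (σ v') else 0 := by
      intro i
      split_ifs with hi
      · rw [hi]
      · exact hoff _ _ fun h => hi (hσi h).symm
    rw [Finset.sum_congr rfl (fun i _ => this i), Finset.sum_ite_eq']
    simp
  -- In the s² coefficient at σ v the neighbour sum vanishes because v is not its own neighbour,
  -- leaving 3γa² = 0 with a ≠ 0.
  have hγ (v : V) : γ v = 0 := by
    obtain ⟨w, hw⟩ := exists_ne (σ v)
    have := (key v (σ v) w hw.symm).2.2.2.1
    rw [hsum] at this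
    simpa [hσ v] using this
  -- This is the st coefficient at the vertices σ v, σ v', divided by the nonzero scalar of v.
  have hadj (v v' : V) (hne : v ≠ v') : (if G.Adj v v' then a v' (σ v') else 0) =
      a v (σ v) ^ 2 * if G.Adj (σ v) (σ v') then 1 else 0 := by
    obtain ⟨-, h1, h2, -, h3⟩ := key v (σ v) (σ v') (hσi.ne hne)
    rw [hoff v (σ v') (hσi.ne hne.symm)] at h2 h3
    rw [hsum, hsum, h1, h2] at h3
    apply mul_left_cancel₀ (hσ v)
    linear_combination h3
  have hiff (v v' : V) : G.Adj (σ v) (σ v') ↔ G.Adj v v' := by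
    by_cases hne : v = v'
    · simp [hne]
    have := hadj v v' hne
    by_cases h1 : G.Adj v v' <;> by_cases h2 : G.Adj (σ v) (σ v')
    · exact iff_of_true h2 h1
    · rw [if_pos h1, if_neg h2, mul_zero] at this
      exact absurd this (hσ v')
    · rw [if_neg h1, if_pos h2, mul_one] at this
      exact absurd this.symm (pow_ne_zero 2 (hσ v))
    · exact iff_of_false h2 h1
  have hsq (v v' : V) (hv : G.Adj v v') : a v' (σ v') = a v (σ v) ^ 2 := by
    have := hadj v v' hv.ne
    rwa [if_pos hv, if_pos ((hiff v v').2 hv), mul_one] at this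
  have hone (v : V) : a v (σ v) = 1 := by
    obtain ⟨v', hv⟩ : ∃ v', G.Adj v v' :=
      hG.preconnected.exists_adj_of_nontrivial v
    have h1 := hsq v v' hv
    have h2 := hsq v' v hv.symm
    rw [h1] at h2
    -- An edge read in both directions gives a = a⁴; connectedness with more than one vertex
    -- supplies an edge at every v.
    have h3 : a v (σ v) ^ 3 = 1 := by
      apply mul_left_cancel₀ (hσ v)
      linear_combination -h2
    exact ((show Odd 3 by decide).strictMono_pow (R := ℚ)).injective (h3.trans (one_pow 3).symm)
  refine ⟨⟨Equiv.ofBijective σ (Finite.injective_iff_bijective.1 hσi), fun {v w} => hiff v w⟩,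
    fun v => ⟨hγ v, ?_, ?_⟩⟩
  · funext w
    change a v w = (Pi.single (σ v) 1 : V → ℚ) w
    by_cases hw : w = σ v
    · subst hw; rw [hone, Pi.single_eq_same]
    · rw [hoff v w hw, Pi.single_eq_of_ne hw]
  · funext w
    change e v w = (Pi.single (σ v) 1 : V → ℚ) w
    by_cases hw : w = σ v
    · subst hw
      obtain ⟨w, hw⟩ := exists_ne (σ v)
      rw [(key v (σ v) w hw.symm).2.1, hone, Pi.single_eq_same, one_pow]
    · have := (key v (σ v) w (Ne.symm hw)).2.2.1
      rw [this, hoff v w hw, Pi.single_eq_of_ne hw, zero_pow three_ne_zero]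

end Rigidity

/-- The first two equations give α⁶ = β⁵. Raising the third to the fifth power gives α^(5(18n+11)) =
α^(6(15n+9)), and the two exponents differ by exactly 1. -/
lemma eq_one_of_pow_eq {n : ℕ} {α β c : ℚ} (hα : α ≠ 0) (h1 : α ^ (18 * n + 11) = c)
    (h2 : α ^ (18 * n + 5) * β ^ 5 = c) (h3 : β ^ (15 * n + 9) = c) : α = 1 ∧ β = 1 ∧ c = 1 := by
  have h4 : α ^ 6 = β ^ 5 := by
    apply mul_left_cancel₀ (pow_ne_zero (18 * n + 5) hα)
    rw [h2, ← h1, ← pow_add]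
  have h5 : α ^ (90 * n + 54) * α = α ^ (90 * n + 54) := by
    calc α ^ (90 * n + 54) * α = (α ^ (18 * n + 11)) ^ 5 := by rw [← pow_succ, ← pow_mul]; ring
      _ = (β ^ 5) ^ (15 * n + 9) := by rw [h1, ← h3, ← pow_mul, ← pow_mul, mul_comm]
      _ = α ^ (90 * n + 54) := by rw [← h4, ← pow_mul]; ring
  have hα1 : α = 1 := mul_left_cancel₀ (pow_ne_zero _ hα) (h5.trans (mul_one _).symm)
  subst hα1
  have hβ : β = 1 := by
    exact ((show Odd 5 by decide).strictMono_pow (R := ℚ)).injective (by simpa using h4.symm)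
  exact ⟨rfl, hβ, by simpa using h1.symm⟩

/-! ### Constructing endomorphisms from generators -/

namespace FreeCGA

variable {I : Type u} {deg : I → ℕ}

/-- Endomorphisms of `(ΛW, d)` from their values on generators. -/
def endOfGens {dg : I → FreeCGA deg} {hdg : ∀ i, dg i ∈ gr deg (deg i + 1)}
    (h : ∀ i, der dg hdg (dg i) = 0) (F : FreeCGA deg →ₐ[ℚ] FreeCGA deg)
    (hF : ∀ i, F (ι deg i) ∈ gr deg (deg i)) (hd : ∀ i, F (dg i) = der dg hdg (F (ι deg i))) :
    CDGA.End (toCDGA dg hdg h) where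
  toAlgHom := F
  map_gr {m a} ha := by
    refine (gr_le (S := (gr deg m).comap F.toLinearMap) fun l hl => ?_) ha
    subst hl
    clear ha
    change F (mon deg l) ∈ gr deg (wt deg l)
    induction l with
    | nil => simpa [mon, wt] using SetLike.GradedOne.one_mem (A := gr deg)
    | cons i l ih =>
      rw [mon_cons, map_mul, wt_cons]
      exact SetLike.GradedMul.mul_mem (hF i) ih
  map_d a := by
    change F (der dg hdg a) = der dg hdg (F a)
    induction a using induction_on with
    | hadd a b ha hb => simp only [map_add, ha, hb]
    | h m a ha =>
      refine (gr_le (S := LinearMap.eqLocus (F.toLinearMap ∘ₗ der dg hdg)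
        (der dg hdg ∘ₗ F.toLinearMap)) fun l hl => ?_) ha
      clear hl
      change F (der dg hdg (mon deg l)) = der dg hdg (F (mon deg l))
      induction l with
      | nil => simp [mon, der]
      | cons i l ih =>
        rw [mon_cons, der_mul _ _ _ (ι_mem i), map_mul F, der_mul _ _ _ (hF i), der_ι, map_add,
          map_mul F, map_smul, map_mul F, hd, ih]

end FreeCGA

/-! ### Test representations and the classification of injective endomorphisms -/

namespace Gen

open FreeCGA CDGA

variable {V : Type u} (n : ℕ)

/-- The action of a permutation of the vertices on the generators. -/
def perm (σ : V → V) : Gen V → Gen V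
  | x v => x (σ v)
  | zv v => zv (σ v)
  | g => g

lemma deg_perm (σ : V → V) (g : Gen V) : deg n (perm σ g) = deg n g := by
  cases g <;> rfl

/-- The action of a permutation of the vertices on `ΛW`. -/
def permHom (σ : V → V) : FreeCGA (deg (V := V) n) →ₐ[ℚ] FreeCGA (deg (V := V) n) :=
  FreeCGA.lift (fun g => el n (perm σ g)) (fun g h => by
    rw [FreeCGA.ι_mul_ι, deg_perm, deg_perm])

lemma permHom_el (σ : V → V) (g : Gen V) : permHom n σ (el n g) = el n (perm σ g) :=
  FreeCGA.lift_ι _ _ g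

section Tests

/-- Together with `oddMat₃`, a faithful matrix model of the exterior algebra in two variables. -/
def oddMat₂ : Matrix (Fin 4) (Fin 4) ℚ := !![0,0,0,0; 1,0,0,0; 0,0,0,0; 0,0,1,0]

/-- See `oddMat₂`. -/
def oddMat₃ : Matrix (Fin 4) (Fin 4) ℚ := !![0,0,0,0; 0,0,0,0; 1,0,0,0; 0,-1,0,0]

lemma oddMat₂_sq : oddMat₂ * oddMat₂ = 0 := by
  ext i j; fin_cases i <;> fin_cases j <;> simp [oddMat₂, Matrix.mul_apply, Fin.sum_univ_four]

lemma oddMat₃_sq : oddMat₃ * oddMat₃ = 0 := by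
  ext i j; fin_cases i <;> fin_cases j <;> simp [oddMat₃, Matrix.mul_apply, Fin.sum_univ_four]

lemma oddMat₃_mul_oddMat₂ : oddMat₃ * oddMat₂ = - (oddMat₂ * oddMat₃) := by
  ext i j
  fin_cases i <;> fin_cases j <;>
    simp [oddMat₂, oddMat₃, Matrix.mul_apply, Fin.sum_univ_four]

lemma oddMat_apply₀ : (oddMat₂ * oddMat₃) 0 0 = 0 := by
  simp [oddMat₂, oddMat₃, Matrix.mul_apply, Fin.sum_univ_four]

lemma oddMat_apply₃ : (oddMat₂ * oddMat₃) 3 0 = 1 := by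
  simp [oddMat₂, oddMat₃, Matrix.mul_apply, Fin.sum_univ_four]

/-- The representation of `ΛW` with `x₁ = 1` in which, besides `x₁`, only `y₂` and `y₃` act
nontrivially. -/
def oddEval : FreeCGA (deg (V := V) n) →ₐ[ℚ] Matrix (Fin 4) (Fin 4) ℚ :=
  FreeCGA.lift (fun g => match g with
    | x₁ => 1 | x₂ => 0 | x _ => 0 | y₁ => 0 | y₂ => oddMat₂ | y₃ => oddMat₃ | z => 0 | zv _ => 0)
    (by
    have e₁ : Even (deg n (x₁ : Gen V)) := ⟨15 * n + 9, by simp only [deg]; ring⟩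
    have o₂ : Odd (deg n (y₂ : Gen V)) := ⟨66 * n + 39, by simp only [deg]; ring⟩
    have o₃ : Odd (deg n (y₃ : Gen V)) := ⟨69 * n + 41, by simp only [deg]; ring⟩
    intro g h
    cases g <;> cases h <;> simp [(e₁.mul_right _).neg_one_pow, (e₁.mul_left _).neg_one_pow,
      (o₂.mul o₂).neg_one_pow, (o₂.mul o₃).neg_one_pow, (o₃.mul o₂).neg_one_pow,
      (o₃.mul o₃).neg_one_pow, oddMat₂_sq, oddMat₃_sq, oddMat₃_mul_oddMat₂])

lemma oddEval_el (g : Gen V) : oddEval n (el n g) = match g with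
    | x₁ => 1 | x₂ => 0 | x _ => 0 | y₁ => 0 | y₂ => oddMat₂ | y₃ => oddMat₃ | z => 0 | zv _ => 0 :=
  FreeCGA.lift_ι _ _ g

lemma evenEval_el (s t : ℚ) (p : V → ℚ) (g : Gen V) : evenEval n s t p (el n g) = match g with
    | x₁ => s | x₂ => t | x w => p w | y₁ => 0 | y₂ => 0 | y₃ => 0 | z => 0 | zv _ => 0 :=
  FreeCGA.lift_ι _ _ g

end Tests

variable [Fintype V] (G : SimpleGraph V) [DecidableRel G.Adj]

lemma oddEval_dGen_z : oddEval n (dGen n G z) = oddMat₂ * oddMat₃ + 1 := by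
  simp [dGen, oddEval_el]

lemma oddEval_dGen_zv (v : V) : oddEval n (dGen n G (zv v)) = 0 := by
  simp [dGen, oddEval_el]

lemma evenEval_dGen_z (p : V → ℚ) : evenEval n 0 1 p (dGen n G z) = 1 := by
  simp [dGen, evenEval_el]

lemma evenEval_dGen_zv (p : V → ℚ) (v : V) : evenEval n 0 1 p (dGen n G (zv v)) =
    p v ^ 3 + ∑ w ∈ G.neighborFinset v, p v * p w := by
  simp [dGen, evenEval_el]

/-- The endomorphism of `M_n(𝒢)` induced by an automorphism of `𝒢`. -/
def autEnd (σ : G ≃g G) : CDGA.End (graphAlgebra n G) :=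
  FreeCGA.endOfGens (der_dGen n G) (permHom n σ)
    (fun g => by
      have h := FreeCGA.ι_mem (deg := deg n) (perm σ g)
      rw [deg_perm] at h
      rwa [permHom_el])
    (fun g => by
      rw [permHom_el, FreeCGA.der_ι]
      cases g with
      | zv v =>
        simp only [dGen, map_add, map_sum, map_mul, map_pow, permHom_el, perm]
        congr 1
        exact Finset.sum_equiv σ.toEquiv (fun w => by
          simpa [SimpleGraph.mem_neighborFinset] using (σ.map_adj_iff (v := v) (w := w)).symm)
          (fun w _ => rfl)
      | _ => simp [dGen, permHom_el, perm])

lemma autEnd_mul (σ τ : G ≃g G) : autEnd n G (σ * τ) = autEnd n G σ * autEnd n G τ := by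
  refine CDGA.Hom.ext (FreeCGA.algHom_ext fun g => ?_)
  change permHom n _ (el n g) = permHom n _ (permHom n _ (el n g))
  rw [permHom_el, permHom_el, permHom_el]
  cases g <;> rfl

lemma autEnd_one : autEnd n G 1 = 1 := by
  refine CDGA.Hom.ext (FreeCGA.algHom_ext fun g => ?_)
  change permHom n _ (el n g) = el n g
  rw [permHom_el]
  cases g <;> rfl

lemma autEnd_injective : Function.Injective (autEnd n G) := by
  classical
  intro σ τ h
  ext v
  have h' : permHom n σ (el n (x v)) = permHom n τ (el n (x v)) :=
    congrArg (fun f : CDGA.End (graphAlgebra n G) =>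
      (f.toAlgHom : FreeCGA (deg (V := V) n) →ₐ[ℚ] FreeCGA (deg (V := V) n)) (el n (x v))) h
  rw [permHom_el, permHom_el] at h'
  have h2 := congrArg (evenEval n 0 0 (Pi.single (σ v) 1)) h'
  simp only [perm, evenEval_el, Pi.single_eq_same, Pi.single_apply] at h2
  by_contra hne
  rw [if_neg (Ne.symm hne)] at h2
  exact one_ne_zero h2

lemma exists_coeffs_of_mem_span {M : Type v} [AddCommGroup M] [Module ℚ M] {m a : M}
    {e : V → M} (h : a ∈ Submodule.span ℚ (insert m (Set.range e))) :
    ∃ (c : ℚ) (b : V → ℚ), a = c • m + ∑ w, b w • e w := by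
  obtain ⟨c, y, hy, rfl⟩ := Submodule.mem_span_insert.1 h
  obtain ⟨b, rfl⟩ := (Submodule.mem_span_range_iff_exists_fun ℚ).1 hy
  exact ⟨c, b, rfl⟩

/-- An injective endomorphism of `M_n(𝒢)` is induced by an automorphism of `𝒢`. -/
theorem exists_autEnd_eq [Nontrivial V] (hG : G.Connected) (f : CDGA.End (graphAlgebra n G))
    (hf : Function.Injective f.toAlgHom) : ∃ σ : G ≃g G, autEnd n G σ = f := by
  classical
  let F : FreeCGA (deg (V := V) n) →ₐ[ℚ] FreeCGA (deg (V := V) n) := f.toAlgHom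
  have hF : Function.Injective F := hf
  have hgr (g : Gen V) : F (el n g) ∈ FreeCGA.gr (deg (V := V) n) (deg n g) :=
    f.map_gr (a := el n g) (FreeCGA.ι_mem g)
  have hd (g : Gen V) : F (dGen n G g) = FreeCGA.der _ (dGen_mem n G) (F (el n g)) := by
    rw [← FreeCGA.der_ι (dGen n G) (dGen_mem n G) g]
    exact f.map_d (el n g)
  have hι (g : Gen V) : FreeCGA.der _ (dGen_mem n G) (el n g) = dGen n G g := FreeCGA.der_ι _ _ g
  obtain ⟨α, hα⟩ := Submodule.mem_span_singleton.1 (gr_x₁_le n (hgr x₁))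
  obtain ⟨β, hβ⟩ := Submodule.mem_span_singleton.1 (gr_x₂_le n (hgr x₂))
  obtain ⟨c₁, h₁⟩ := Submodule.mem_span_singleton.1 (gr_y_le (by simp) (hgr y₁))
  obtain ⟨c₂, h₂⟩ := Submodule.mem_span_singleton.1 (gr_y_le (by simp) (hgr y₂))
  obtain ⟨c₃, h₃⟩ := Submodule.mem_span_singleton.1 (gr_y_le (by simp) (hgr y₃))
  -- At x₁ = x₂ = 1 the differential of each y becomes 1, so evaluating F(dy) = d(F y) reads off the
  -- scalar.
  have e₁ : c₁ = α ^ 3 * β := by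
    have h := congrArg (evenEval n 1 1 0) (hd y₁)
    rw [← h₁, map_smul, hι] at h
    simpa [dGen, ← hα, ← hβ, evenEval_el, mul_comm] using h.symm
  have e₂ : c₂ = α ^ 2 * β ^ 2 := by
    have h := congrArg (evenEval n 1 1 0) (hd y₂)
    rw [← h₂, map_smul, hι] at h
    simpa [dGen, ← hα, ← hβ, evenEval_el] using h.symm
  have e₃ : c₃ = α * β ^ 3 := by
    have h := congrArg (evenEval n 1 1 0) (hd y₃)
    rw [← h₃, map_smul, hι] at h
    simpa [dGen, ← hα, ← hβ, evenEval_el] using h.symm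
  have hα0 : α ≠ 0 := by
    rintro rfl
    rw [zero_smul, ← map_zero F] at hα
    have h := congrArg (evenEval n 1 0 0) (hF hα)
    simp [evenEval_el] at h
  obtain ⟨c, b, hz⟩ := exists_coeffs_of_mem_span (gr_z_le n (hgr z))
  have hdz : F (dGen n G z) = c • dGen n G z + ∑ w, b w • dGen n G (zv w) := by
    rw [hd, hz]
    simp only [map_add, map_smul, map_sum, hι]
  -- With x₁ = 1 and x₂ = y₁ = x_v = 0, dz becomes y₂y₃ + 1 and every dz_v dies. In the matrix
  -- model, entry (0,0) reads the coefficient of 1 and entry (3,0) that of y₂y₃.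
  have hodd : (α ^ (18 * n) * (α ^ 2 * c₂ * c₃)) • (oddMat₂ * oddMat₃) +
      α ^ (18 * n + 11) • (1 : Matrix (Fin 4) (Fin 4) ℚ) = c • (oddMat₂ * oddMat₃ + 1) := by
    have h := congrArg (oddEval n) hdz
    simp only [map_add, map_sum, map_smul, oddEval_dGen_z, oddEval_dGen_zv, smul_zero,
      Finset.sum_const_zero, add_zero] at h
    rw [← h]
    simp [dGen, ← hα, ← hβ, ← h₁, ← h₂, ← h₃, oddEval_el, smul_pow, smul_smul]
    ring_nf
  have hc₁ : α ^ (18 * n + 11) = c := by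
    have h := congrFun (congrFun hodd 0) 0
    simpa [oddMat_apply₀] using h
  have hc₂ : α ^ (18 * n + 5) * β ^ 5 = c := by
    have h := congrFun (congrFun hodd 3) 0
    simp [oddMat_apply₃] at h
    rw [← h, e₂, e₃]
    ring
  -- At x₁ = 0, x₂ = 1 only x₂^(15n+9) survives in dz, while the dz_w become the cubics of the
  -- graph. The point p = 0 then isolates c, and the coordinate points give b = 0.
  have heven (p : V → ℚ) : β ^ (15 * n + 9) =
      c + ∑ w, b w * (p w ^ 3 + ∑ y ∈ G.neighborFinset w, p w * p y) := by
    have h := congrArg (evenEval n 0 1 p) hdz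
    simp only [map_add, map_sum, map_smul, evenEval_dGen_z, evenEval_dGen_zv] at h
    simp [dGen, ← hα, ← hβ, ← h₁, ← h₂, ← h₃, evenEval_el] at h
    exact h
  have hc₃ : β ^ (15 * n + 9) = c := by simpa using heven 0
  have hb (w : V) : b w = 0 := by
    have h := heven (Pi.single w 1)
    rw [hc₃, Finset.sum_eq_single w (fun i _ hi => by simp [Pi.single_eq_of_ne hi]) (by simp),
      Finset.sum_eq_zero fun y hy => ?_] at h
    · simpa using h
    · have : y ≠ w := ((G.mem_neighborFinset w y).1 hy).ne'
      rw [Pi.single_eq_of_ne this, mul_zero]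
  obtain ⟨rfl, rfl, rfl⟩ := eq_one_of_pow_eq hα0 hc₁ hc₂ hc₃
  choose γ a hx using fun v => exists_coeffs_of_mem_span (gr_x_le n v (hgr (x v)))
  choose c' e hzv using fun v => exists_coeffs_of_mem_span (gr_z_le n (hgr (zv v)))
  have hdzv (v : V) : F (dGen n G (zv v)) = c' v • dGen n G z + ∑ w, e v w • dGen n G (zv w) := by
    rw [hd, hzv]
    simp only [map_add, map_smul, map_sum, hι]
  -- F(dz_v) lies in the ideal generated by x₂ and the x_w, which the odd test kills, whereas dz has
  -- constant entry 1 there.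
  have hc' (v : V) : c' v = 0 := by
    have h := congrArg (fun a => oddEval n a 0 0) (hdzv v)
    simp only [map_add, map_sum, map_smul, oddEval_dGen_z, oddEval_dGen_zv, smul_zero,
      Finset.sum_const_zero, add_zero] at h
    simpa [dGen, hx, oddEval_el, oddMat_apply₀] using h.symm
  obtain ⟨σ, hσ⟩ := exists_aut_of_cubic_identity G hG a e γ (by
    intro v p
    have h := congrArg (evenEval n 0 1 p) (hdzv v)
    simp only [map_sum, map_smul, evenEval_dGen_zv, hc', zero_smul, zero_add] at h
    simpa [dGen, hx, ← hβ, evenEval_el] using h) (by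
    intro k hk
    -- A relation between the rows of a leaves only a multiple of x₂^N, itself in the image since β
    -- = 1. Injectivity of F, evaluated at x₂ = 0, then gives k = 0.
    have h : F (∑ v, k v • el n (x v)) = F ((∑ v, k v * γ v) • el n x₂ ^ (5 * n + 3)) := by
      simp only [map_sum, map_smul, map_pow, hx, ← hβ, one_smul, smul_add, Finset.smul_sum,
        smul_smul, Finset.sum_add_distrib, ← Finset.sum_smul]
      rw [Finset.sum_comm]
      simp only [← Finset.sum_smul, hk, zero_smul, Finset.sum_const_zero, add_zero]
    funext v
    have h2 := congrArg (evenEval n 0 0 (Pi.single v 1)) (hF h)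
    simpa [evenEval_el, Pi.single_apply] using h2)
  refine ⟨σ, CDGA.Hom.ext (FreeCGA.algHom_ext fun g => ?_)⟩
  change permHom n σ (el n g) = F (el n g)
  rw [permHom_el]
  cases g with
  | x₁ => simpa [perm] using hα
  | x₂ => simpa [perm] using hβ
  | y₁ => simpa [e₁, perm] using h₁
  | y₂ => simpa [e₂, perm] using h₂
  | y₃ => simpa [e₃, perm] using h₃
  | z => simp [hz, hb, perm]
  | x v => simp [hx, (hσ v).1, (hσ v).2.1, perm, Pi.single_apply]
  | zv v => simp [hzv, hc', (hσ v).2.2, perm, Pi.single_apply]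

theorem selfEquiv_mulEquiv_aut [Nontrivial V] (hG : G.Connected) (hn : 1 ≤ n) :
    Nonempty ((graphAlgebra n G).SelfEquiv ≃* (G ≃g G)) := by
  let A := graphAlgebra n G
  have heq {f f' : CDGA.End A} (h : (f : HomotopyClasses A) = f') : f = f' := by
    have h' : Relation.EqvGen Homotopic f f' := (Con.eq _).1 h
    clear h
    induction h' with
    | rel _ _ h => exact eq_of_homotopic n G hn h
    | refl _ => rfl
    | symm _ _ _ ih => exact ih.symm
    | trans _ _ _ _ _ ih ih' => exact ih.trans ih'
  let φ : (G ≃g G) →* HomotopyClasses A :=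
    A.homotopyCon.mk'.comp ⟨⟨autEnd n G, autEnd_one n G⟩, autEnd_mul n G⟩
  refine ⟨(MulEquiv.ofBijective φ.toHomUnits ⟨fun σ τ h => ?_, fun u => ?_⟩).symm⟩
  · exact autEnd_injective n G (heq (congrArg Units.val h))
  · obtain ⟨f, hf⟩ := Con.mk'_surjective (c := A.homotopyCon) u.val
    obtain ⟨f', hf'⟩ := Con.mk'_surjective (c := A.homotopyCon) u.inv
    -- An inverse up to homotopy is a strict inverse, because homotopic endomorphisms are equal;
    -- only the left inverse is needed, for injectivity.
    have h1 : f' * f = 1 := heq (by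
      change A.homotopyCon.mk' (f' * f) = A.homotopyCon.mk' 1
      rw [map_mul, hf, hf', u.inv_val, map_one])
    have hinj : Function.Injective f.toAlgHom :=
      Function.LeftInverse.injective (g := f'.toAlgHom) fun a =>
        congrArg (fun k : CDGA.End A => k.toAlgHom a) h1
    obtain ⟨σ, rfl⟩ := exists_autEnd_eq n G hG f hinj
    exact ⟨σ, Units.ext hf⟩

end Gen

end

theorem mainTheorem2 {V : Type*} [Fintype V] [Nontrivial V] (G : SimpleGraph V)
    [DecidableRel G.Adj] (hG : G.Connected) (n : ℕ) (hn : 1 ≤ n) :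
    (graphAlgebra n G).IsMinimalSullivan ∧
      (graphAlgebra n G).IsConnected (30 * n + 17) ∧
      Nonempty ((graphAlgebra n G).SelfEquiv ≃* (G ≃g G)) :=
  ⟨Gen.isMinimalSullivan n G, Gen.isConnected n G, Gen.selfEquiv_mulEquiv_aut n G hG hn⟩
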